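/- Let $d\ge 1$ be an integer, $T>0$, $k_1>0$ and $H\in(0,1)$ with $Hd<1$. There exist constants $C>0$ and $\lambda_0>0$, depending only on $d,T,H,k_1$, such that the following holds. Let $W=(W_t)_{t\ge 0}$ be a standard $d$-dimensional Brownian motion on a probability space $(\Omega,\mathcal F,P)$. Let $K(t,s)$ be a measurable real kernel with $\int_0^t K(t,s)^2\,ds<\infty$ for all $t\ge 0$ and $$\int_s^t K(t,\theta)^2\,d\theta\;\ge\; k_1\,(t-s)^{2H}\qquad\text{for all } 0\le s<t\le T,$$ and let $B=(B_t)_{t\ge 0}$ be a jointly measurable version of the $d$-dimensional Gaussian process $B_t=\int_0^t K(t,s)\,dW_s$ (that is, $B^i_t=\int_0^tK(t,s)\,dW^i_s$ as a Wiener integral, for $i=1,\dots,d$). For $\varepsilon>0$ put $$L_\varepsilon=\int_0^T\!\!\int_0^t p_\varepsilon(B_t-B_s)\,ds\,dt,\qquad p_\varepsilon(x)=(2\pi\varepsilon)^{-d/2}\exp\Big(-\frac{|x|^2}{2\varepsilon}\Big),\quad x\in\mathbb R^d.$$ Then $L_\varepsilon$ converges in $L^2(\Omega)$ as $\varepsilon\downarrow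 0$. Its limit $L$, the self-intersection local time of $B$ on $[0,T]$, satisfies $L\ge 0$ almost surely, and $$E(L^n)\le C^n\,(n!)^{Hd}\qquad\text{for all integers } n\ge 1.$$ Moreover $E\big(e^{L^p}\big)<\infty$ for every $0\le p<\frac1{Hd}$, and $E\big(e^{\lambda L^{1/(Hd)}}\big)<\infty$ for every real $\lambda<\lambda_0$. -/

import Mathlib

open MeasureTheory ProbabilityTheory Filter Topology
open scoped NNReal ENNReal

noncomputable section

namespace SelfIntersection

variable {Ω : Type*} [MeasurableSpace Ω]

/-- A process `W` with values in `ℝ^d` is a standard `d`-dimensional Brownian motion: its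
coordinates are independent (as processes) standard real Brownian motions. -/
structure IsBrownian {d : ℕ} (W : ℝ≥0 → Ω → EuclideanSpace ℝ (Fin d)) (P : Measure Ω) :
    Prop where
  coord : ∀ i, IsBrownianReal (fun t ω => W t ω i) P
  indep : iIndepFun (fun (i : Fin d) (ω : Ω) (t : ℝ≥0) => W t ω i) P

/-- The data of a step function `∑ j, coeff j * 1_{(left j, right j]}` on `[0, ∞)`. -/
structure StepFunction where
  n : ℕ
  coeff : Fin n → ℝ
  left : Fin n → ℝ≥0
  right : Fin n → ℝ≥0
  left_le_right : ∀ j, left j ≤ right j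

/-- The step function as a function of time. -/
def StepFunction.eval (f : StepFunction) (r : ℝ) : ℝ :=
  ∑ j, f.coeff j * (Set.Ioc (f.left j : ℝ) (f.right j : ℝ)).indicator (fun _ => (1 : ℝ)) r

/-- The elementary integral of a step function with respect to a real process `w`. -/
def StepFunction.integral (f : StepFunction) (w : ℝ≥0 → Ω → ℝ) (ω : Ω) : ℝ :=
  ∑ j, f.coeff j * (w (f.right j) ω - w (f.left j) ω)

/-- `X` is (a version of) the Wiener integral `∫₀^∞ h(r) dw_r` of the square integrable
deterministic function `h` on `[0, ∞)`: it is the limit in `L²(P)` of the elementary integrals of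
step functions that converge to `h` in `L²([0, ∞))`. -/
def IsWienerIntegral (w : ℝ≥0 → Ω → ℝ) (P : Measure Ω) (h : ℝ → ℝ) (X : Ω → ℝ) : Prop :=
  MemLp h 2 (volume.restrict (Set.Ici (0 : ℝ))) ∧ MemLp X 2 P ∧
    ∃ f : ℕ → StepFunction,
      Tendsto (fun m => eLpNorm (fun r => (f m).eval r - h r) 2
        (volume.restrict (Set.Ici (0 : ℝ)))) atTop (𝓝 0) ∧
      Tendsto (fun m => eLpNorm (fun ω => (f m).integral w ω - X ω) 2 P) atTop (𝓝 0)

/-- `B_t = ∫₀ᵗ K(t,s) dW_s` for all `t ≥ 0`, coordinate by coordinate. -/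
def IsKernelProcess {d : ℕ} (K : ℝ → ℝ → ℝ) (W B : ℝ≥0 → Ω → EuclideanSpace ℝ (Fin d))
    (P : Measure Ω) : Prop :=
  ∀ (t : ℝ≥0) (i : Fin d),
    IsWienerIntegral (fun r ω => W r ω i) P ((Set.Ioc 0 (t : ℝ)).indicator (K t))
      (fun ω => B t ω i)

/-- The heat kernel `(2πε)^{-d/2} exp(-|x|²/(2ε))` on `ℝ^d`. -/
def heatKernel {d : ℕ} (ε : ℝ) (x : EuclideanSpace ℝ (Fin d)) : ℝ :=
  (2 * Real.pi * ε) ^ (-(d : ℝ) / 2) * Real.exp (-‖x‖ ^ 2 / (2 * ε))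

/-- The approximation `L_ε = ∫₀ᵀ ∫₀ᵗ p_ε(B_t - B_s) ds dt`. -/
def approxLocalTime {d : ℕ} (B : ℝ≥0 → Ω → EuclideanSpace ℝ (Fin d)) (T ε : ℝ) (ω : Ω) : ℝ :=
  ∫ t in (0 : ℝ)..T, ∫ s in (0 : ℝ)..t, heatKernel ε (B t.toNNReal ω - B s.toNNReal ω)

/-- `L` is (a version of) the self-intersection local time of `B` on `[0, T]`: the limit in
`L²(P)` of `L_ε` as `ε ↓ 0`. -/
def IsSelfIntersectionLocalTime {d : ℕ} (B : ℝ≥0 → Ω → EuclideanSpace ℝ (Fin d))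
    (P : Measure Ω) (T : ℝ) (L : Ω → ℝ) : Prop :=
  (∀ ε : ℝ, 0 < ε → MemLp (approxLocalTime B T ε) 2 P) ∧ MemLp L 2 P ∧
    Tendsto (fun ε : ℝ => eLpNorm (fun ω => approxLocalTime B T ε ω - L ω) 2 P)
      (𝓝[>] 0) (𝓝 0)

end SelfIntersection

end

noncomputable section

namespace SelfIntersection

open scoped RealInnerProductSpace

/-! ### The Wiener integral as an isometry, and characteristic functions of its values. -/

section Brownian

variable {Ω : Type*} [MeasurableSpace Ω] {P : Measure Ω} {d : ℕ}
  {W : ℝ≥0 → Ω → EuclideanSpace ℝ (Fin d)}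

/-! By the Wiener isometry the increments of `B` are jointly centred Gaussian, with independent
coordinates and covariance read off from the curve h(t) = K(t,·)1_{(0,t]} in L². Writing each heat
kernel as a Fourier integral (`integral_prod_heatKernel`) turns a mixed moment E ∏ L_{ε_k} into an
integral over pairs (t_k, s_k) of the d-th power of the Gaussian integral (2π)^{-n} ∫ exp(-½‖∑ ξ_k
(h(t_k) - h(s_k))‖² - ½ ∑ ε_k ξ_k²) dξ.

Existence: this expression decreases in every ε_k, so E(L_ε L_η) ≥ E(L_η²) for ε ≤ η. Hence ‖L_ε -
L_η‖² ≤ ‖L_ε‖² - ‖L_η‖², and since second moments are bounded, the family is Cauchy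
(`exists_tendsto_of_norm_sq_le_inner`).

Moments: drop the ε_k and order the pairs by t, at the cost of a factor n!. If r is the preceding t,
the component K(t,·)1_{(max(s,r),t]} of h(t) - h(s) is orthogonal to h(s) and to all earlier
increments, and its squared norm is at least k₁(t - max(s,r))^{2H}. By `gaussianIntegral_succ_le`
each new pair therefore costs at most a constant times (t - max(s,r))^{-H}. With γ = Hd < 1, the
d-th powers of these weights are integrable; discounting the last time at rate n/T bounds the
integral of their product by c^n (n!)^{-(1-γ)}, and the factor n! from the ordering leaves (n!)^γ.

Fatou's lemma carries the bound to L. Interpolating it to the exponents k/γ and summing the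
exponential series gives integrability of exp(λ L^{1/γ}) for small λ, hence of exp(L^p) for p < 1/γ.
-/

lemma IsBrownian.isGaussianProcess (hW : IsBrownian W P) :
    IsGaussianProcess (fun (p : Fin d × ℝ≥0) ω => W p.2 ω p.1) P where
  hasGaussianLaw I := by
    classical
    -- `I` need not be a product set. All coordinates are taken over the common set of times, where
    -- independence gives a Gaussian vector, and the wanted family is a linear image of it.
    let J : Finset ℝ≥0 := I.image Prod.snd
    have h1 : ∀ j : Fin d, HasGaussianLaw (fun ω => J.restrict (fun t => W t ω j)) P :=
      fun j => ((hW.coord j).hasLaw J).hasGaussianLaw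
    have h2 : iIndepFun (fun (j : Fin d) ω => J.restrict (fun t => W t ω j)) P :=
      hW.indep.comp (fun _ => J.restrict) (fun _ => by fun_prop)
    have h3 := h2.hasGaussianLaw h1
    let L : (Fin d → (J → ℝ)) →L[ℝ] (I → ℝ) := ContinuousLinearMap.pi fun p =>
      (ContinuousLinearMap.proj (R := ℝ) (φ := fun _ : J => ℝ)
        ⟨p.1.2, Finset.mem_image_of_mem _ p.2⟩).comp
        (ContinuousLinearMap.proj (R := ℝ) (φ := fun _ : Fin d => J → ℝ) p.1.1)
    exact h3.map_fun L

lemma IsBrownian.memLp_two (hW : IsBrownian W P) (j : Fin d) (u : ℝ≥0) :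
    MemLp (fun ω => W u ω j) 2 P :=
  ((hW.coord j).hasLaw_eval u).hasGaussianLaw.memLp_two

lemma IsBrownian.integral_eq_zero (hW : IsBrownian W P) (j : Fin d) (u : ℝ≥0) :
    ∫ ω, W u ω j ∂P = 0 :=
  (hW.coord j).integral_eval u

lemma IsBrownian.integral_mul [IsProbabilityMeasure P] (hW : IsBrownian W P) (i j : Fin d)
    (u v : ℝ≥0) :
    ∫ ω, W u ω i * W v ω j ∂P = if i = j then ((min u v : ℝ≥0) : ℝ) else 0 := by
  have hcov := covariance_eq_sub (hW.memLp_two i u) (hW.memLp_two j v)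
  rw [hW.integral_eq_zero, hW.integral_eq_zero, mul_zero, sub_zero] at hcov
  change _ = ∫ ω, W u ω i * W v ω j ∂P at hcov
  rw [← hcov]
  split_ifs with hij
  · subst hij
    exact (hW.coord i).covariance_eval u v
  · refine IndepFun.covariance_eq_zero ?_ (hW.memLp_two i u) (hW.memLp_two j v)
    exact (hW.indep.indepFun hij).comp (measurable_pi_apply u) (measurable_pi_apply v)

/-- The restriction of Lebesgue measure to the time axis `[0, ∞)`. -/
abbrev timeMeasure : Measure ℝ := volume.restrict (Set.Ici (0 : ℝ))

/-- The Hilbert space of square integrable integrands with values in `ℝ^d`. -/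
abbrev Integrand (d : ℕ) : Type := PiLp 2 (fun _ : Fin d => Lp ℝ 2 timeMeasure)

/-- The integrand with a single nonzero coordinate. -/
def Integrand.single (j : Fin d) : Lp ℝ 2 timeMeasure →L[ℝ] Integrand d :=
  (PiLp.continuousLinearEquiv 2 ℝ
    (fun _ : Fin d => Lp ℝ 2 timeMeasure)).symm.toContinuousLinearMap.comp
    (ContinuousLinearMap.single ℝ (fun _ : Fin d => Lp ℝ 2 timeMeasure) j)

lemma Integrand.single_apply (j i : Fin d) (f : Lp ℝ 2 timeMeasure) :
    Integrand.single j f i = if i = j then f else 0 := by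
  simp only [Integrand.single, ContinuousLinearMap.comp_apply, ContinuousLinearEquiv.coe_coe,
    ContinuousLinearMap.single_apply]
  exact Pi.single_apply j f i

lemma timeMeasure_Ioc_ne_top (u : ℝ≥0) : timeMeasure (Set.Ioc (0 : ℝ) u) ≠ ∞ :=
  ((Measure.restrict_apply_le _ _).trans_lt measure_Ioc_lt_top).ne

/-- The indicator function of `(0, u]` as an element of `L²`. -/
def timeIndicator (u : ℝ≥0) : Lp ℝ 2 timeMeasure :=
  indicatorConstLp 2 measurableSet_Ioc (timeMeasure_Ioc_ne_top u) 1

lemma inner_timeIndicator (u v : ℝ≥0) :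
    ⟪timeIndicator u, timeIndicator v⟫ = ((min u v : ℝ≥0) : ℝ) := by
  rw [timeIndicator, timeIndicator, L2.inner_indicatorConstLp_one_indicatorConstLp_one
    measurableSet_Ioc measurableSet_Ioc (timeMeasure_Ioc_ne_top u) (timeMeasure_Ioc_ne_top v)]
  simp only [Set.Ioc_inter_Ioc, max_self, RCLike.ofReal_real_eq_id, id_eq]
  rw [measureReal_restrict_apply measurableSet_Ioc, Set.inter_eq_left.2]
  · simp
  · exact fun x hx => hx.1.le

/-- The integrand–integral pair of the elementary integrand `1_{(0, u]} e_j`. -/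
def IsBrownian.generator (hW : IsBrownian W P) (p : Fin d × ℝ≥0) : Integrand d × Lp ℝ 2 P :=
  (Integrand.single p.1 (timeIndicator p.2), (hW.memLp_two p.1 p.2).toLp _)

/-- The graph of the Wiener integral on step functions. -/
def IsBrownian.graph (hW : IsBrownian W P) : Submodule ℝ (Integrand d × Lp ℝ 2 P) :=
  Submodule.span ℝ (Set.range hW.generator)

lemma IsBrownian.inner_generator [IsProbabilityMeasure P] (hW : IsBrownian W P)
    (p q : Fin d × ℝ≥0) :
    ⟪(hW.generator p).2, (hW.generator q).2⟫ = ⟪(hW.generator p).1, (hW.generator q).1⟫ := by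
  simp only [generator]
  rw [L2.inner_def, PiLp.inner_apply]
  have h1 : ∫ a, ⟪(hW.memLp_two p.1 p.2).toLp _ a, (hW.memLp_two q.1 q.2).toLp _ a⟫ ∂P
      = ∫ a, W p.2 a p.1 * W q.2 a q.1 ∂P := by
    refine integral_congr_ae ?_
    filter_upwards [(hW.memLp_two p.1 p.2).coeFn_toLp, (hW.memLp_two q.1 q.2).coeFn_toLp]
      with a h1 h2
    rw [h1, h2]
    simp [mul_comm]
  rw [h1, hW.integral_mul]
  simp only [Integrand.single_apply]
  by_cases hpq : p.1 = q.1
  · rw [Finset.sum_eq_single p.1]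
    · simp [hpq, inner_timeIndicator]
    · intro b _ hb
      simp [hb]
    · simp
  · rw [if_neg hpq, Finset.sum_eq_zero]
    intro i _
    by_cases hi : i = p.1
    · have : i ≠ q.1 := fun h => hpq (hi ▸ h)
      simp [this]
    · simp [hi]

/-- The Itô isometry for step functions: both inner products are bilinear, so their agreement on
generators extends to the span. -/
lemma IsBrownian.norm_snd_eq [IsProbabilityMeasure P] (hW : IsBrownian W P)
    {p : Integrand d × Lp ℝ 2 P} (hp : p ∈ hW.graph) : ‖p.2‖ = ‖p.1‖ := by
  have key : ∀ p ∈ hW.graph, ∀ q ∈ hW.graph, ⟪p.2, q.2⟫ = ⟪p.1, q.1⟫ := by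
    intro p hp q hq
    induction hp, hq using Submodule.span_induction₂ with
    | mem_mem x y hx hy =>
      obtain ⟨x, rfl⟩ := hx
      obtain ⟨y, rfl⟩ := hy
      exact hW.inner_generator x y
    | zero_left => simp
    | zero_right => simp
    | add_left _ _ _ _ _ _ h1 h2 =>
      rw [Prod.fst_add, Prod.snd_add, inner_add_left, inner_add_left, h1, h2]
    | add_right _ _ _ _ _ _ h1 h2 =>
      rw [Prod.fst_add, Prod.snd_add, inner_add_right, inner_add_right, h1, h2]
    | smul_left r _ _ _ _ h =>
      rw [Prod.smul_fst, Prod.smul_snd, real_inner_smul_left, real_inner_smul_left, h]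
    | smul_right r _ _ _ _ h =>
      rw [Prod.smul_fst, Prod.smul_snd, real_inner_smul_right, real_inner_smul_right, h]
  have h := key p hp p hp
  rw [real_inner_self_eq_norm_sq, real_inner_self_eq_norm_sq] at h
  exact (sq_eq_sq₀ (norm_nonneg _) (norm_nonneg _)).1 h

lemma coeFn_finset_sum_smul {ι : Type*} (s : Finset ι) (c : ι → ℝ) (F : ι → Lp ℝ 2 P)
    (f : ι → Ω → ℝ) (h : ∀ i ∈ s, F i =ᵐ[P] f i) :
    ((∑ i ∈ s, c i • F i : Lp ℝ 2 P) : Ω → ℝ) =ᵐ[P] fun ω => ∑ i ∈ s, c i * f i ω := by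
  classical
  induction s using Finset.induction_on with
  | empty =>
    simp only [Finset.sum_empty]
    exact Lp.coeFn_zero ℝ 2 P
  | insert a s ha ih =>
    rw [Finset.sum_insert ha]
    filter_upwards [Lp.coeFn_add (c a • F a) (∑ i ∈ s, c i • F i), Lp.coeFn_smul (c a) (F a),
      h a (Finset.mem_insert_self _ _), ih fun i hi => h i (Finset.mem_insert_of_mem hi)]
      with ω h1 h2 h3 h4
    rw [h1, Pi.add_apply, h2, Pi.smul_apply, h3, h4, Finset.sum_insert ha, smul_eq_mul]

/-- An element of the span is a finite linear combination of Brownian values, hence a centred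
Gaussian variable; the isometry identifies its variance. -/
lemma IsBrownian.integral_cexp_graph [IsProbabilityMeasure P] (hW : IsBrownian W P)
    {p : Integrand d × Lp ℝ 2 P} (hp : p ∈ hW.graph) :
    ∫ ω, Complex.exp (p.2 ω * Complex.I) ∂P = ((Real.exp (-‖p.1‖ ^ 2 / 2) : ℝ) : ℂ) := by
  have hnorm := hW.norm_snd_eq hp
  obtain ⟨c, hc⟩ := (Finsupp.mem_span_range_iff_exists_finsupp).1 hp
  set X : Ω → ℝ := fun ω => ∑ q ∈ c.support, c q * W q.2 ω q.1 with hX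
  have hpX : p.2 =ᵐ[P] X := by
    have : p.2 = ∑ q ∈ c.support, c q • (hW.generator q).2 := by
      rw [← hc, Finsupp.sum, Prod.snd_sum]
      rfl
    rw [this]
    exact coeFn_finset_sum_smul _ _ _ _ fun q _ => (hW.memLp_two q.1 q.2).coeFn_toLp
  have hmean : ∫ ω, X ω ∂P = 0 := by
    rw [integral_finsetSum]
    · refine Finset.sum_eq_zero fun q _ => ?_
      rw [integral_const_mul, hW.integral_eq_zero, mul_zero]
    · exact fun q _ => ((hW.memLp_two q.1 q.2).integrable one_le_two).const_mul _
  have hG : HasGaussianLaw X P := by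
    let L : (c.support → ℝ) →L[ℝ] ℝ := ∑ q : c.support, c q • ContinuousLinearMap.proj q
    have hXL : X = fun ω => L (c.support.restrict fun q => W q.2 ω q.1) := by
      funext ω
      simp only [hX, L, sum_apply, smul_apply, ContinuousLinearMap.proj_apply, Finset.restrict,
        smul_eq_mul]
      exact (Finset.sum_coe_sort c.support fun q => c q * W q.2 ω q.1).symm
    rw [hXL]
    exact (hW.isGaussianProcess.hasGaussianLaw c.support).map_fun L
  have hvar : Var[X; P] = ‖p.1‖ ^ 2 := by
    rw [variance_of_integral_eq_zero hG.aemeasurable hmean, ← hnorm, ← real_inner_self_eq_norm_sq,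
      L2.inner_def]
    refine integral_congr_ae ?_
    filter_upwards [hpX] with ω h
    rw [h]
    simp [sq]
  have hlaw := hG.map_eq_gaussianReal
  rw [hmean, hvar] at hlaw
  have hchar := charFun_gaussianReal (μ := 0) (v := (‖p.1‖ ^ 2).toNNReal) 1
  rw [← hlaw, charFun_apply_real, integral_map hG.aemeasurable (by fun_prop)] at hchar
  rw [Real.coe_toNNReal _ (sq_nonneg _)] at hchar
  calc _ = ∫ ω, Complex.exp (X ω * Complex.I) ∂P := by
        refine integral_congr_ae ?_
        filter_upwards [hpX] with ω h
        rw [h]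
    _ = _ := by
        simp only [Complex.ofReal_one, one_mul] at hchar
        rw [hchar]
        push_cast
        congr 1
        ring

lemma norm_cexp_mul_I_sub_le (x y : ℝ) :
    ‖Complex.exp (x * Complex.I) - Complex.exp (y * Complex.I)‖ ≤ |x - y| := by
  have h : Complex.exp (x * Complex.I) - Complex.exp (y * Complex.I)
      = Complex.exp (y * Complex.I) * (Complex.exp (Complex.I * ((x - y : ℝ) : ℂ)) - 1) := by
    rw [mul_sub, ← Complex.exp_add, mul_one]
    congr 2
    push_cast
    ring
  rw [h, norm_mul, Complex.norm_exp_ofReal_mul_I, one_mul]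
  exact Real.norm_exp_I_mul_ofReal_sub_one_le

lemma integrable_cexp_mul_I [IsFiniteMeasure P] {X : Ω → ℝ} (hX : AEStronglyMeasurable X P) :
    Integrable (fun ω => Complex.exp (X ω * Complex.I)) P := by
  refine Integrable.of_bound (C := 1) ?_ (ae_of_all _ fun ω => ?_)
  · have : Continuous fun x : ℝ => Complex.exp (x * Complex.I) := by fun_prop
    exact this.comp_aestronglyMeasurable hX
  · rw [Complex.norm_exp_ofReal_mul_I]

/-- The map x ↦ e^{ix} is 1-Lipschitz and the L¹ norm is at most the L² norm under a probability
measure. This lets the Gaussian formula pass to L² limits. -/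
lemma continuous_integral_cexp [IsProbabilityMeasure P] :
    Continuous fun X : Lp ℝ 2 P => ∫ ω, Complex.exp (X ω * Complex.I) ∂P := by
  refine LipschitzWith.continuous (K := 1) (LipschitzWith.of_dist_le_mul fun X Y => ?_)
  rw [NNReal.coe_one, one_mul, dist_eq_norm, dist_eq_norm, ← integral_sub
    (integrable_cexp_mul_I (Lp.aestronglyMeasurable X))
    (integrable_cexp_mul_I (Lp.aestronglyMeasurable Y))]
  have hi : Integrable (fun ω => (X - Y) ω) P := (Lp.memLp (X - Y)).integrable one_le_two
  calc _ ≤ ∫ ω, ‖Complex.exp (X ω * Complex.I) - Complex.exp (Y ω * Complex.I)‖ ∂P :=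
        norm_integral_le_integral_norm _
    _ ≤ ∫ ω, ‖(X - Y) ω‖ ∂P := by
        refine integral_mono_ae ?_ hi.norm ?_
        · exact ((integrable_cexp_mul_I (Lp.aestronglyMeasurable X)).sub
            (integrable_cexp_mul_I (Lp.aestronglyMeasurable Y))).norm
        · filter_upwards [Lp.coeFn_sub X Y] with ω h
          rw [h]
          exact norm_cexp_mul_I_sub_le _ _
    _ = (eLpNorm (X - Y) 1 P).toReal := by
        rw [eLpNorm_one_eq_lintegral_enorm, integral_norm_eq_lintegral_enorm hi.1]
    _ ≤ (eLpNorm (X - Y) 2 P).toReal := by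
        refine ENNReal.toReal_mono ?_ (eLpNorm_le_eLpNorm_of_exponent_le one_le_two ?_)
        · exact (Lp.memLp (X - Y)).eLpNorm_ne_top
        · exact (Lp.memLp (X - Y)).1
    _ = ‖X - Y‖ := by
        rw [Lp.norm_def]

lemma IsBrownian.integral_cexp_closure [IsProbabilityMeasure P] (hW : IsBrownian W P)
    {p : Integrand d × Lp ℝ 2 P} (hp : p ∈ hW.graph.topologicalClosure) :
    ∫ ω, Complex.exp (p.2 ω * Complex.I) ∂P = ((Real.exp (-‖p.1‖ ^ 2 / 2) : ℝ) : ℂ) := by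
  have hclosed : IsClosed {p : Integrand d × Lp ℝ 2 P |
      ∫ ω, Complex.exp (p.2 ω * Complex.I) ∂P = ((Real.exp (-‖p.1‖ ^ 2 / 2) : ℝ) : ℂ)} :=
    isClosed_eq (continuous_integral_cexp.comp continuous_snd) (by fun_prop)
  exact closure_minimal (fun q hq => hW.integral_cexp_graph hq) hclosed hp

lemma timeIndicator_coeFn (u : ℝ≥0) :
    timeIndicator u =ᵐ[timeMeasure] (Set.Ioc (0 : ℝ) u).indicator fun _ => (1 : ℝ) :=
  indicatorConstLp_coeFn

lemma indicator_Ioc_eq_sub {a b : ℝ≥0} (hab : a ≤ b) (r : ℝ) :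
    (Set.Ioc (a : ℝ) b).indicator (fun _ => (1 : ℝ)) r =
      (Set.Ioc (0 : ℝ) b).indicator (fun _ => (1 : ℝ)) r -
        (Set.Ioc (0 : ℝ) a).indicator (fun _ => (1 : ℝ)) r := by
  have h0 : (0 : ℝ) ≤ a := a.2
  have h1 : (a : ℝ) ≤ b := hab
  simp only [Set.indicator_apply, Set.mem_Ioc]
  by_cases h2 : r ≤ a
  · simp [h2, h2.trans h1, not_lt.2 h2]
  · simp [h2, not_le.1 h2, h0.trans_lt (not_le.1 h2)]

/-- The Wiener integral lies in the closed graph generated by the Brownian motion. -/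
lemma IsBrownian.mem_closure_of_isWienerIntegral [IsProbabilityMeasure P] (hW : IsBrownian W P)
    {j : Fin d} {h : ℝ → ℝ} {X : Ω → ℝ}
    (hX : IsWienerIntegral (fun r ω => W r ω j) P h X) :
    (Integrand.single j (hX.1.toLp h), hX.2.1.toLp X) ∈ hW.graph.topologicalClosure := by
  obtain ⟨f, hf, hI⟩ := hX.2.2
  let F : ℕ → Lp ℝ 2 timeMeasure := fun m =>
    ∑ i, (f m).coeff i • (timeIndicator ((f m).right i) - timeIndicator ((f m).left i))
  let G : ℕ → Lp ℝ 2 P := fun m => ∑ i, (f m).coeff i •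
    ((hW.memLp_two j ((f m).right i)).toLp _ - (hW.memLp_two j ((f m).left i)).toLp _)
  have hF : ∀ m, F m =ᵐ[timeMeasure] (f m).eval := fun m => by
    refine (coeFn_finset_sum_smul _ _ _ (fun i r => (Set.Ioc ((f m).left i : ℝ)
      ((f m).right i : ℝ)).indicator (fun _ => (1 : ℝ)) r) fun i _ => ?_)
    filter_upwards [Lp.coeFn_sub (timeIndicator ((f m).right i)) (timeIndicator ((f m).left i)),
      timeIndicator_coeFn ((f m).right i), timeIndicator_coeFn ((f m).left i)] with r h1 h2 h3
    rw [h1, Pi.sub_apply, h2, h3, indicator_Ioc_eq_sub ((f m).left_le_right i)]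
  have hG : ∀ m, G m =ᵐ[P] (f m).integral (fun r ω => W r ω j) := fun m => by
    refine (coeFn_finset_sum_smul _ _ _
      (fun i ω => W ((f m).right i) ω j - W ((f m).left i) ω j) fun i _ => ?_)
    filter_upwards [Lp.coeFn_sub ((hW.memLp_two j ((f m).right i)).toLp _)
      ((hW.memLp_two j ((f m).left i)).toLp _), (hW.memLp_two j ((f m).right i)).coeFn_toLp,
      (hW.memLp_two j ((f m).left i)).coeFn_toLp] with r h1 h2 h3
    rw [h1, Pi.sub_apply, h2, h3]
  have hFt : Tendsto F atTop (𝓝 (hX.1.toLp h)) := by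
    rw [Lp.tendsto_Lp_iff_tendsto_eLpNorm']
    refine hf.congr fun m => eLpNorm_congr_ae ?_
    filter_upwards [hF m, hX.1.coeFn_toLp] with r h1 h2
    rw [Pi.sub_apply, h1, h2]
  have hGt : Tendsto G atTop (𝓝 (hX.2.1.toLp X)) := by
    rw [Lp.tendsto_Lp_iff_tendsto_eLpNorm']
    refine hI.congr fun m => eLpNorm_congr_ae ?_
    filter_upwards [hG m, hX.2.1.coeFn_toLp] with r h1 h2
    rw [Pi.sub_apply, h1, h2]
  refine mem_closure_of_tendsto
    ((((Integrand.single j).continuous.tendsto _).comp hFt).prodMk_nhds hGt)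
    (Eventually.of_forall fun m => ?_)
  have : ((Integrand.single j (F m), G m) : Integrand d × Lp ℝ 2 P) = ∑ i, (f m).coeff i •
      (hW.generator (j, (f m).right i) - hW.generator (j, (f m).left i)) := by
    refine Prod.ext ?_ ?_
    · simp only [Prod.fst_sum, Prod.smul_fst, Prod.fst_sub, F, map_sum, map_smul, map_sub]
      rfl
    · simp only [Prod.snd_sum, Prod.smul_snd, Prod.snd_sub, G]
      rfl
  simp only [Function.comp_apply, SetLike.mem_coe]
  rw [this]
  exact Submodule.sum_mem _ fun i _ => Submodule.smul_mem _ _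
    (Submodule.sub_mem _ (Submodule.subset_span ⟨_, rfl⟩) (Submodule.subset_span ⟨_, rfl⟩))

end Brownian

/-! ### Gaussian increments of the kernel process. -/

section Kernel

variable {Ω : Type*} [MeasurableSpace Ω] {P : Measure Ω} {d : ℕ}
  {W B : ℝ≥0 → Ω → EuclideanSpace ℝ (Fin d)} {K : ℝ → ℝ → ℝ}

/-- Joint characteristic function of finitely many increments of the process `B`, where
`h t = K(t, ·) 1_{(0, t]}`. -/
lemma IsKernelProcess.integral_cexp_increments [IsProbabilityMeasure P]
    (hB : IsKernelProcess K W B P) (hW : IsBrownian W P) (h : ℝ≥0 → Lp ℝ 2 timeMeasure)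
    (hh : ∀ t, h t =ᵐ[timeMeasure] (Set.Ioc 0 (t : ℝ)).indicator (K t))
    {n : ℕ} (s t : Fin n → ℝ≥0) (ξ : Fin d → Fin n → ℝ) :
    ∫ ω, Complex.exp ((∑ j, ∑ k, ξ j k * (B (t k) ω j - B (s k) ω j) : ℝ) * Complex.I) ∂P =
      ((Real.exp (-(∑ j, ‖∑ k, ξ j k • (h (t k) - h (s k))‖ ^ 2) / 2) : ℝ) : ℂ) := by
  let Y : ℝ≥0 → Fin d → Lp ℝ 2 P := fun u j => (hB u j).2.1.toLp _
  have hmem : ∀ u j, (Integrand.single j (h u), Y u j) ∈ hW.graph.topologicalClosure := by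
    intro u j
    have : h u = (hB u j).1.toLp _ := by
      refine Lp.ext ((hh u).trans ?_)
      exact (MemLp.coeFn_toLp _).symm
    rw [this]
    exact hW.mem_closure_of_isWienerIntegral (hB u j)
  -- `S` is the integrand of the linear combination and `A` its stochastic integral. The pair stays
  -- in the closed graph by linearity, so the one-variable formula gives the joint characteristic
  -- function.
  obtain ⟨S, hS⟩ : ∃ S : Integrand d,
      S = ∑ j, Integrand.single j (∑ k, ξ j k • (h (t k) - h (s k))) := ⟨_, rfl⟩
  obtain ⟨A, hA⟩ : ∃ A : Lp ℝ 2 P,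
      A = ∑ p : Fin d × Fin n, ξ p.1 p.2 • (Y (t p.2) p.1 - Y (s p.2) p.1) := ⟨_, rfl⟩
  have hsum : (S, A) ∈ hW.graph.topologicalClosure := by
    have : (S, A) = ∑ j, ∑ k, ξ j k • ((Integrand.single j (h (t k)), Y (t k) j) -
        (Integrand.single j (h (s k)), Y (s k) j)) := by
      refine Prod.ext ?_ ?_
      · simp only [hS, Prod.fst_sum, Prod.smul_fst, Prod.fst_sub, map_sum, map_smul, map_sub]
      · simp only [hA, Prod.snd_sum, Prod.smul_snd, Prod.snd_sub]
        rw [← Finset.univ_product_univ, Finset.sum_product]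
    rw [this]
    exact Submodule.sum_mem _ fun j _ => Submodule.sum_mem _ fun k _ => Submodule.smul_mem _ _
      (Submodule.sub_mem _ (hmem _ _) (hmem _ _))
  have key : ∫ ω, Complex.exp (A ω * Complex.I) ∂P = ((Real.exp (-‖S‖ ^ 2 / 2) : ℝ) : ℂ) :=
    hW.integral_cexp_closure hsum
  have hnorm : ‖S‖ ^ 2 = ∑ j, ‖∑ k, ξ j k • (h (t k) - h (s k))‖ ^ 2 := by
    rw [PiLp.norm_sq_eq_of_L2]
    refine Finset.sum_congr rfl fun j _ => ?_
    congr 2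
    rw [hS, WithLp.ofLp_sum, Finset.sum_apply]
    simp only [Integrand.single_apply]
    rw [Finset.sum_ite_eq]
    simp
  rw [← hnorm, ← key]
  refine integral_congr_ae ?_
  have hae : A =ᵐ[P] fun ω => ∑ p : Fin d × Fin n, ξ p.1 p.2 *
        (B (t p.2) ω p.1 - B (s p.2) ω p.1) := by
    rw [hA]
    have hY : ∀ u j, Y u j =ᵐ[P] fun ω => B u ω j := fun u j => (hB u j).2.1.coeFn_toLp
    refine coeFn_finset_sum_smul Finset.univ (fun p : Fin d × Fin n => ξ p.1 p.2)
      (fun p => Y (t p.2) p.1 - Y (s p.2) p.1) (fun p ω => B (t p.2) ω p.1 - B (s p.2) ω p.1)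
      fun p _ => ?_
    filter_upwards [Lp.coeFn_sub (Y (t p.2) p.1) (Y (s p.2) p.1), hY (t p.2) p.1,
      hY (s p.2) p.1] with ω h1 h2 h3
    rw [h1, Pi.sub_apply, h2, h3]
  filter_upwards [hae] with ω hω
  rw [hω, ← Finset.univ_product_univ, Finset.sum_product]

end Kernel

/-! ### The heat kernel and its Fourier representation. -/

section HeatKernel

lemma heatKernel_eq_prod {d : ℕ} {ε : ℝ} (hε : 0 < ε) (x : EuclideanSpace ℝ (Fin d)) :
    heatKernel ε x = ∏ j, ((2 * Real.pi * ε) ^ (-(1 : ℝ) / 2) * Real.exp (-x j ^ 2 / (2 * ε))) := by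
  have h2 : 0 ≤ 2 * Real.pi * ε := by positivity
  have h3 : (2 * Real.pi * ε) ^ (-(d : ℝ) / 2) = ((2 * Real.pi * ε) ^ (-(1 : ℝ) / 2)) ^ d := by
    rw [← Real.rpow_natCast, ← Real.rpow_mul h2]
    congr 1
    ring
  rw [heatKernel, Finset.prod_mul_distrib, ← Real.exp_sum, Finset.prod_const, Finset.card_univ,
    Fintype.card_fin, h3, EuclideanSpace.real_norm_sq_eq, ← Finset.sum_div, Finset.sum_neg_distrib]

lemma heatKernel_nonneg {d : ℕ} {ε : ℝ} (hε : 0 < ε) (x : EuclideanSpace ℝ (Fin d)) :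
    0 ≤ heatKernel ε x := by
  rw [heatKernel]
  positivity

lemma heatKernel_le {d : ℕ} {ε : ℝ} (hε : 0 < ε) (x : EuclideanSpace ℝ (Fin d)) :
    heatKernel ε x ≤ (2 * Real.pi * ε) ^ (-(d : ℝ) / 2) := by
  rw [heatKernel]
  refine mul_le_of_le_one_right (by positivity) (Real.exp_le_one_iff.2 ?_)
  rw [neg_div, neg_nonpos]
  positivity

lemma continuous_heatKernel {d : ℕ} (ε : ℝ) :
    Continuous (heatKernel ε : EuclideanSpace ℝ (Fin d) → ℝ) := by
  unfold heatKernel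
  fun_prop

/-- The one-dimensional heat kernel as a Fourier integral. -/
lemma gaussian_eq_fourier {ε : ℝ} (hε : 0 < ε) (x : ℝ) :
    (((2 * Real.pi * ε) ^ (-(1 : ℝ) / 2) * Real.exp (-x ^ 2 / (2 * ε)) : ℝ) : ℂ) =
      ((2 * Real.pi)⁻¹ : ℝ) * ∫ ξ : ℝ, Complex.exp ((ξ * x : ℝ) * Complex.I) *
        ((Real.exp (-(ε * ξ ^ 2) / 2) : ℝ) : ℂ) := by
  have h := fourierIntegral_gaussian (b := ((ε / 2 : ℝ) : ℂ)) (by simpa using half_pos hε) x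
  have h1 : ∫ ξ : ℝ, Complex.exp ((ξ * x : ℝ) * Complex.I) *
        ((Real.exp (-(ε * ξ ^ 2) / 2) : ℝ) : ℂ) =
      ∫ ξ : ℝ, Complex.exp (Complex.I * x * ξ) * Complex.exp (-((ε / 2 : ℝ) : ℂ) * ξ ^ 2) := by
    refine integral_congr_ae (ae_of_all _ fun ξ => ?_)
    simp only
    push_cast
    congr 2 <;> ring
  have h2 : ((Real.pi : ℂ) / ((ε / 2 : ℝ) : ℂ)) ^ (1 / 2 : ℂ) =
      (((2 * Real.pi / ε) ^ ((1 : ℝ) / 2) : ℝ) : ℂ) := by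
    rw [Complex.ofReal_cpow (by positivity)]
    push_cast
    congr 1
    field_simp
  have h3 : (2 * Real.pi * ε) ^ (-(1 : ℝ) / 2) =
      (2 * Real.pi)⁻¹ * (2 * Real.pi / ε) ^ ((1 : ℝ) / 2) := by
    have hp : 0 < 2 * Real.pi := by positivity
    rw [Real.mul_rpow hp.le hε.le, Real.div_rpow hp.le hε.le, neg_div, Real.rpow_neg hp.le,
      Real.rpow_neg hε.le, ← Real.sqrt_eq_rpow, ← Real.sqrt_eq_rpow]
    have := Real.sqrt_ne_zero'.2 hp
    have h4 := Real.sqrt_ne_zero'.2 hε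
    have h5 := Real.sq_sqrt hp.le
    field_simp
    exact h5.symm
  rw [h1, h, h2, h3]
  push_cast
  rw [mul_assoc]
  congr 3
  field_simp
  ring_nf

end HeatKernel

/-! ### Gaussian integrals attached to finite families of Hilbert space vectors. -/

section GaussianIntegral

variable {E : Type*} [NormedAddCommGroup E] [InnerProductSpace ℝ E] {n : ℕ}

/-- The Gaussian integral attached to the vectors `g` and the regularisation parameters `ε`; it is
`(2π)^{-n/2} det(Gram(g) + diag(ε))^{-1/2}`. -/
def regGaussian (ε : Fin n → ℝ) (g : Fin n → E) : ℝ :=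
  (2 * Real.pi)⁻¹ ^ n * ∫ ξ : Fin n → ℝ,
    Real.exp (-‖∑ k, ξ k • g k‖ ^ 2 / 2) * Real.exp (-(∑ k, ε k * ξ k ^ 2) / 2)

lemma integrable_exp_neg_sum {ε : Fin n → ℝ} (hε : ∀ k, 0 < ε k) :
    Integrable (fun ξ : Fin n → ℝ => Real.exp (-(∑ k, ε k * ξ k ^ 2) / 2)) := by
  have h : (fun ξ : Fin n → ℝ => Real.exp (-(∑ k, ε k * ξ k ^ 2) / 2)) =
      fun ξ => ∏ k, Real.exp (-(ε k / 2) * ξ k ^ 2) := by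
    funext ξ
    rw [← Real.exp_sum, ← Finset.sum_neg_distrib, Finset.sum_div]
    congr 1
    exact Finset.sum_congr rfl fun k _ => by ring
  rw [h]
  exact Integrable.fintype_prod fun k => integrable_exp_neg_mul_sq (half_pos (hε k))

lemma exp_neg_norm_sq_le_one {E : Type*} [SeminormedAddCommGroup E] (v : E) :
    Real.exp (-‖v‖ ^ 2 / 2) ≤ 1 := by
  rw [Real.exp_le_one_iff, neg_div, neg_nonpos]
  positivity

lemma integrable_regGaussian {ε : Fin n → ℝ} (hε : ∀ k, 0 < ε k) (g : Fin n → E) :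
    Integrable (fun ξ : Fin n → ℝ =>
      Real.exp (-‖∑ k, ξ k • g k‖ ^ 2 / 2) * Real.exp (-(∑ k, ε k * ξ k ^ 2) / 2)) := by
  refine (integrable_exp_neg_sum hε).mono' ?_ (ae_of_all _ fun ξ => ?_)
  · exact Continuous.aestronglyMeasurable (by fun_prop)
  · rw [Real.norm_of_nonneg (by positivity)]
    exact mul_le_of_le_one_left (Real.exp_nonneg _) (exp_neg_norm_sq_le_one _)

lemma regGaussian_nonneg (ε : Fin n → ℝ) (g : Fin n → E) : 0 ≤ regGaussian ε g := by
  unfold regGaussian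
  exact mul_nonneg (by positivity) (integral_nonneg fun ξ => by positivity)

lemma regGaussian_anti {ε η : Fin n → ℝ} (hε : ∀ k, 0 < ε k) (h : ∀ k, ε k ≤ η k)
    (g : Fin n → E) : regGaussian η g ≤ regGaussian ε g := by
  unfold regGaussian
  refine mul_le_mul_of_nonneg_left (integral_mono
    (integrable_regGaussian (fun k => (hε k).trans_le (h k)) g) (integrable_regGaussian hε g)
    fun ξ => ?_) (by positivity)
  simp only
  gcongr
  exact h _

variable {Ω : Type*} [MeasurableSpace Ω] {P : Measure Ω} {d : ℕ}

/-- The expectation of a product of heat kernels evaluated at a Gaussian vector with independent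
identically distributed coordinates. -/
lemma integral_prod_heatKernel [IsProbabilityMeasure P] {Z : Fin n → Ω → EuclideanSpace ℝ (Fin d)}
    (hZ : ∀ k, Measurable (Z k)) {g : Fin n → E}
    (hchar : ∀ ξ : Fin d → Fin n → ℝ,
      ∫ ω, Complex.exp ((∑ j, ∑ k, ξ j k * Z k ω j : ℝ) * Complex.I) ∂P =
        ((Real.exp (-(∑ j, ‖∑ k, ξ j k • g k‖ ^ 2) / 2) : ℝ) : ℂ))
    {ε : Fin n → ℝ} (hε : ∀ k, 0 < ε k) :
    ∫ ω, ∏ k, heatKernel (ε k) (Z k ω) ∂P = regGaussian ε g ^ d := by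
  set w : (Fin d → Fin n → ℝ) → ℝ := fun ξ => ∏ j, Real.exp (-(∑ k, ε k * ξ j k ^ 2) / 2) with hw
  have hwi : Integrable w := Integrable.fintype_prod fun _ => integrable_exp_neg_sum hε
  set c : ℂ := (((2 * Real.pi)⁻¹ : ℝ) ^ n : ℂ) ^ d with hc
  have hpt : ∀ ω, ((∏ k, heatKernel (ε k) (Z k ω) : ℝ) : ℂ) = c *
      ∫ ξ : Fin d → Fin n → ℝ,
        Complex.exp ((∑ j, ∑ k, ξ j k * Z k ω j : ℝ) * Complex.I) * ((w ξ : ℝ) : ℂ) := by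
    intro ω
    have h1 : ((∏ k, heatKernel (ε k) (Z k ω) : ℝ) : ℂ) = ∏ j : Fin d, ∏ k : Fin n,
        (((2 * Real.pi)⁻¹ : ℝ) * ∫ ξ : ℝ, Complex.exp ((ξ * Z k ω j : ℝ) * Complex.I) *
        ((Real.exp (-(ε k * ξ ^ 2) / 2) : ℝ) : ℂ)) := by
      rw [Complex.ofReal_prod, Finset.prod_comm]
      refine Finset.prod_congr rfl fun k _ => ?_
      rw [heatKernel_eq_prod (hε k), Complex.ofReal_prod]
      exact Finset.prod_congr rfl fun j _ => gaussian_eq_fourier (hε k) _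
    rw [h1]
    simp only [Finset.prod_mul_distrib, Finset.prod_const, Finset.card_univ, Fintype.card_fin]
    rw [hc]
    congr 1
    have h2 : ∀ j : Fin d, (∏ k : Fin n, ∫ ξ : ℝ, Complex.exp ((ξ * Z k ω j : ℝ) * Complex.I) *
        ((Real.exp (-(ε k * ξ ^ 2) / 2) : ℝ) : ℂ)) =
        ∫ η : Fin n → ℝ, ∏ k : Fin n, (Complex.exp ((η k * Z k ω j : ℝ) * Complex.I) *
        ((Real.exp (-(ε k * η k ^ 2) / 2) : ℝ) : ℂ)) := fun j =>
      (integral_fintype_prod_volume_eq_prod (fun (k : Fin n) (ξ : ℝ) =>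
        Complex.exp ((ξ * Z k ω j : ℝ) * Complex.I) *
        ((Real.exp (-(ε k * ξ ^ 2) / 2) : ℝ) : ℂ))).symm
    rw [Finset.prod_congr rfl fun j _ => h2 j]
    rw [← integral_fintype_prod_volume_eq_prod (fun (j : Fin d) (η : Fin n → ℝ) =>
      ∏ k : Fin n, (Complex.exp ((η k * Z k ω j : ℝ) * Complex.I) *
        ((Real.exp (-(ε k * η k ^ 2) / 2) : ℝ) : ℂ)))]
    refine integral_congr_ae (ae_of_all _ fun ξ => ?_)
    simp only [hw, Finset.prod_mul_distrib]
    congr 1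
    · rw [Complex.ofReal_sum, Finset.sum_mul, Complex.exp_sum]
      refine Finset.prod_congr rfl fun j _ => ?_
      rw [Complex.ofReal_sum, Finset.sum_mul, Complex.exp_sum]
    · rw [Complex.ofReal_prod]
      refine Finset.prod_congr rfl fun j _ => ?_
      rw [← Complex.ofReal_prod, ← Real.exp_sum, ← Finset.sum_neg_distrib, Finset.sum_div]
  -- Fubini applies because the oscillating factor has modulus one and the Gaussian weight `w`,
  -- present thanks to ε > 0, is integrable in ξ.
  have hswap : ∫ ω, ∫ ξ : Fin d → Fin n → ℝ,
      Complex.exp ((∑ j, ∑ k, ξ j k * Z k ω j : ℝ) * Complex.I) * ((w ξ : ℝ) : ℂ) ∂volume ∂P =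
      ∫ ξ : Fin d → Fin n → ℝ, ∫ ω,
      Complex.exp ((∑ j, ∑ k, ξ j k * Z k ω j : ℝ) * Complex.I) * ((w ξ : ℝ) : ℂ) ∂P ∂volume := by
    refine integral_integral_swap ?_
    refine ((integrable_const (1 : ℝ)).mul_prod hwi).mono' ?_ (ae_of_all _ fun p => ?_)
    · have h1 : Measurable fun p : Ω × (Fin d → Fin n → ℝ) =>
          ∑ j, ∑ k, p.2 j k * Z k p.1 j := by
        refine Finset.measurable_sum _ fun j _ => Finset.measurable_sum _ fun k _ => ?_
        have h2 : Measurable fun p : Ω × (Fin d → Fin n → ℝ) => Z k p.1 j :=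
          (EuclideanSpace.proj (𝕜 := ℝ) j).measurable.comp ((hZ k).comp measurable_fst)
        have h3 : Measurable fun p : Ω × (Fin d → Fin n → ℝ) => p.2 j k :=
          (measurable_pi_apply k).comp ((measurable_pi_apply j).comp measurable_snd)
        exact h3.mul h2
      have h4 : Measurable fun p : Ω × (Fin d → Fin n → ℝ) => w p.2 := by
        have : Continuous w := by fun_prop
        exact this.measurable.comp measurable_snd
      refine Measurable.aestronglyMeasurable ?_
      exact (Complex.continuous_exp.measurable.comp
        ((Complex.measurable_ofReal.comp h1).mul_const _)).mul (Complex.measurable_ofReal.comp h4)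
    · simp only [Function.uncurry]
      rw [norm_mul, Complex.norm_exp_ofReal_mul_I, Complex.norm_real, Real.norm_of_nonneg]
      exact Finset.prod_nonneg fun _ _ => Real.exp_nonneg _
  have hmain : ((∫ ω, ∏ k, heatKernel (ε k) (Z k ω) ∂P : ℝ) : ℂ) =
      ((regGaussian ε g ^ d : ℝ) : ℂ) := by
    rw [← integral_complex_ofReal, integral_congr_ae (ae_of_all _ hpt), integral_const_mul, hswap,
      regGaussian]
    simp_rw [integral_mul_const, hchar]
    push_cast
    rw [mul_pow, hc]
    push_cast
    congr 1
    rw [← integral_complex_ofReal]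
    have := integral_fintype_prod_volume_eq_pow (ι := Fin d) (fun η : Fin n → ℝ =>
      ((Real.exp (-‖∑ k, η k • g k‖ ^ 2 / 2) * Real.exp (-(∑ k, ε k * η k ^ 2) / 2) : ℝ) : ℂ))
    rw [Fintype.card_fin] at this
    rw [← this]
    refine integral_congr_ae (ae_of_all _ fun ξ => ?_)
    simp only [hw]
    rw [← Complex.ofReal_prod, Finset.prod_mul_distrib, ← Real.exp_sum (s := Finset.univ)
      (f := fun j => -‖∑ k, ξ j k • g k‖ ^ 2 / 2), ← Finset.sum_div, Finset.sum_neg_distrib]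
    push_cast
    rfl
  exact_mod_cast hmain

/-- The unregularised Gaussian integral. -/
def gaussianIntegral (g : Fin n → E) : ℝ≥0∞ :=
  ∫⁻ ξ : Fin n → ℝ, ENNReal.ofReal (Real.exp (-‖∑ k, ξ k • g k‖ ^ 2 / 2))

/-- Guards against 0 · ∞ = 0 when a degenerate pair of times contributes an infinite weight. -/
lemma gaussianIntegral_ne_zero (g : Fin n → E) : gaussianIntegral g ≠ 0 := by
  unfold gaussianIntegral
  rw [← pos_iff_ne_zero, lintegral_pos_iff_support]
  · have : (Function.support fun ξ : Fin n → ℝ =>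
        ENNReal.ofReal (Real.exp (-‖∑ k, ξ k • g k‖ ^ 2 / 2))) = Set.univ := by
      ext ξ
      simp [Real.exp_pos]
    rw [this]
    exact Measure.measure_univ_pos.2 (NeZero.ne _)
  · exact (Continuous.measurable (by fun_prop)).ennreal_ofReal

lemma ofReal_regGaussian_le {ε : Fin n → ℝ} (hε : ∀ k, 0 < ε k) (g : Fin n → E) :
    ENNReal.ofReal (regGaussian ε g) ≤
      ENNReal.ofReal ((2 * Real.pi)⁻¹) ^ n * gaussianIntegral g := by
  rw [regGaussian, ENNReal.ofReal_mul (by positivity), ENNReal.ofReal_pow (by positivity),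
    ofReal_integral_eq_lintegral_ofReal (integrable_regGaussian hε g)
      (ae_of_all _ fun ξ => by positivity)]
  refine mul_le_mul_right (lintegral_mono fun ξ => ENNReal.ofReal_le_ofReal ?_) _
  refine mul_le_of_le_one_right (Real.exp_nonneg _) (Real.exp_le_one_iff.2 ?_)
  rw [neg_div, neg_nonpos]
  have : 0 ≤ ∑ k, ε k * ξ k ^ 2 := Finset.sum_nonneg fun k _ => mul_nonneg (hε k).le (sq_nonneg _)
  positivity

/-- The part of `v` in the span of `g` is absorbed by translating ξ; by Pythagoras the orthogonal
part only makes the integrand smaller. -/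
lemma lintegral_exp_shift_le (g : Fin n → E) (v : E) :
    ∫⁻ ξ : Fin n → ℝ, ENNReal.ofReal (Real.exp (-‖∑ k, ξ k • g k + v‖ ^ 2 / 2)) ≤
      gaussianIntegral g := by
  let S : Submodule ℝ E := Submodule.span ℝ (Set.range g)
  have : FiniteDimensional ℝ S := FiniteDimensional.span_of_finite ℝ (Set.finite_range g)
  obtain ⟨p, hp, q, hq, hv⟩ := S.exists_add_mem_mem_orthogonal v
  obtain ⟨c, hc⟩ := (Submodule.mem_span_range_iff_exists_fun ℝ).1 hp
  calc _ ≤ ∫⁻ ξ : Fin n → ℝ,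
        ENNReal.ofReal (Real.exp (-‖∑ k, (ξ + c) k • g k‖ ^ 2 / 2)) := by
        refine lintegral_mono fun ξ => ENNReal.ofReal_le_ofReal (Real.exp_le_exp.2 ?_)
        have h1 : ∑ k, (ξ + c) k • g k = ∑ k, ξ k • g k + p := by
          simp [add_smul, Finset.sum_add_distrib, hc]
        have h2 : ∑ k, (ξ + c) k • g k ∈ S :=
          Submodule.sum_mem _ fun k _ => S.smul_mem _ (Submodule.subset_span ⟨k, rfl⟩)
        have h3 : ‖∑ k, ξ k • g k + v‖ * ‖∑ k, ξ k • g k + v‖ =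
            ‖∑ k, (ξ + c) k • g k‖ * ‖∑ k, (ξ + c) k • g k‖ + ‖q‖ * ‖q‖ := by
          rw [hv, ← add_assoc, ← h1]
          exact norm_add_sq_eq_norm_sq_add_norm_sq_real (hq _ h2)
        nlinarith [mul_self_nonneg ‖q‖]
    _ = _ := by
        rw [gaussianIntegral]
        exact lintegral_add_right_eq_self (μ := (volume : Measure (Fin n → ℝ)))
          (fun ξ : Fin n → ℝ => ENNReal.ofReal (Real.exp (-‖∑ k, ξ k • g k‖ ^ 2 / 2))) c

/-- Adding a vector multiplies the Gaussian integral by at most the one-dimensional Gaussian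
integral of any component orthogonal to the previous vectors. -/
lemma gaussianIntegral_succ_le (g : Fin (n + 1) → E) (w : E)
    (hw : ∀ k : Fin n, ⟪g k.castSucc, w⟫ = 0) (hlast : ⟪g (Fin.last n) - w, w⟫ = 0) :
    gaussianIntegral g ≤ gaussianIntegral (fun k : Fin n => g k.castSucc) *
      ∫⁻ x : ℝ, ENNReal.ofReal (Real.exp (-(‖w‖ ^ 2 / 2) * x ^ 2)) := by
  have hmp := (volume_preserving_piFinSuccAbove (fun _ : Fin (n + 1) => ℝ) (Fin.last n)).symm
  have hF : Measurable fun ξ : Fin (n + 1) → ℝ =>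
      ENNReal.ofReal (Real.exp (-‖∑ k, ξ k • g k‖ ^ 2 / 2)) :=
    (Continuous.measurable (by fun_prop)).ennreal_ofReal
  rw [gaussianIntegral, ← hmp.lintegral_comp hF, Measure.volume_eq_prod,
    lintegral_prod _ (by exact (hF.comp hmp.measurable).aemeasurable), ← lintegral_const_mul]
  swap
  · exact (Continuous.measurable (by fun_prop)).ennreal_ofReal
  refine lintegral_mono fun x => ?_
  calc _ = ∫⁻ ξ : Fin n → ℝ, ENNReal.ofReal (Real.exp (-(‖w‖ ^ 2 / 2) * x ^ 2)) *
        ENNReal.ofReal (Real.exp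
          (-‖∑ k, ξ k • g k.castSucc + x • (g (Fin.last n) - w)‖ ^ 2 / 2)) := by
        refine lintegral_congr fun ξ => ?_
        rw [← ENNReal.ofReal_mul (Real.exp_nonneg _), ← Real.exp_add]
        congr 2
        -- The last vector is split as (g - w) + w. The part x • w is orthogonal to the rest and
        -- factors out, while x • (g - w) remains as a shift, to be removed by
        -- `lintegral_exp_shift_le`.
        have h1 : ∑ k, ((MeasurableEquiv.piFinSuccAbove (fun _ : Fin (n + 1) => ℝ)
            (Fin.last n)).symm (x, ξ)) k • g k =
            (∑ k, ξ k • g k.castSucc + x • (g (Fin.last n) - w)) + x • w := by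
          rw [Fin.sum_univ_castSucc]
          simp [MeasurableEquiv.piFinSuccAbove_symm_apply, Fin.insertNthEquiv, smul_sub, add_assoc]
        have h2 : ⟪∑ k, ξ k • g k.castSucc + x • (g (Fin.last n) - w), x • w⟫ = 0 := by
          rw [inner_add_left, sum_inner, inner_smul_left, inner_smul_right, hlast]
          simp [inner_smul_left, inner_smul_right, hw]
        have h3 := norm_add_sq_eq_norm_sq_add_norm_sq_real h2
        rw [h1]
        rw [norm_smul x w, Real.norm_eq_abs] at h3
        have h4 := abs_mul_abs_self x
        have h5 : |x| * ‖w‖ * (|x| * ‖w‖) = x ^ 2 * ‖w‖ ^ 2 := by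
          rw [mul_mul_mul_comm, h4]
          ring
        rw [h5, ← sq, ← sq] at h3
        rw [h3]
        ring
    _ ≤ _ := by
        rw [lintegral_const_mul _ (Continuous.measurable (by fun_prop)).ennreal_ofReal, mul_comm]
        exact mul_le_mul_left (lintegral_exp_shift_le _ _) _

lemma lintegral_gaussian {a : ℝ} (ha : 0 < a) :
    ∫⁻ x : ℝ, ENNReal.ofReal (Real.exp (-(a ^ 2 / 2) * x ^ 2)) =
      ENNReal.ofReal (Real.sqrt (2 * Real.pi) * a⁻¹) := by
  rw [← ofReal_integral_eq_lintegral_ofReal (integrable_exp_neg_mul_sq (by positivity))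
    (ae_of_all _ fun x => Real.exp_nonneg _), integral_gaussian]
  congr 1
  rw [show Real.pi / (a ^ 2 / 2) = 2 * Real.pi / a ^ 2 by field_simp,
    Real.sqrt_div' _ (sq_nonneg a), Real.sqrt_sq ha.le, div_eq_mul_inv]

end GaussianIntegral

/-! ### Iterated integrals of singular weights along ordered times. -/

section Chain

/-- The last first-coordinate of a finite sequence of pairs, or `0` for the empty sequence. -/
def lastTime : {n : ℕ} → (Fin n → ℝ × ℝ) → ℝ
  | 0, _ => 0
  | n + 1, x => (x (Fin.last n)).1

/-- The singular weight `(t - max s r)^{-γ}` of a pair `(t, s)` with `0 < s ≤ t` and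
`r ≤ t ≤ T`. -/
def stepWeight (T γ r : ℝ) (p : ℝ × ℝ) : ℝ≥0∞ :=
  {p : ℝ × ℝ | r ≤ p.1 ∧ p.1 ≤ T ∧ 0 < p.2 ∧ p.2 ≤ p.1}.indicator
    (fun p => ENNReal.ofReal (p.1 - max p.2 r) ^ (-γ)) p

/-- The product of the step weights along a finite sequence of pairs `(t, s)`. -/
def chainWeight (T γ : ℝ) : {n : ℕ} → (Fin n → ℝ × ℝ) → ℝ≥0∞
  | 0, _ => 1
  | _ + 1, x => chainWeight T γ (Fin.init x) *
      stepWeight T γ (lastTime (Fin.init x)) (x (Fin.last _))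

lemma lastTime_succ {n : ℕ} (x : Fin (n + 1) → ℝ × ℝ) : lastTime x = (x (Fin.last n)).1 := rfl

lemma chainWeight_succ (T γ : ℝ) {n : ℕ} (x : Fin (n + 1) → ℝ × ℝ) :
    chainWeight T γ x = chainWeight T γ (Fin.init x) *
      stepWeight T γ (lastTime (Fin.init x)) (x (Fin.last n)) := rfl

lemma measurable_lastTime {n : ℕ} : Measurable (lastTime : (Fin n → ℝ × ℝ) → ℝ) := by
  cases n with
  | zero => exact measurable_const
  | succ n => exact measurable_fst.comp (measurable_pi_apply (Fin.last n))

lemma measurable_stepWeight (T γ : ℝ) :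
    Measurable fun q : ℝ × ℝ × ℝ => stepWeight T γ q.1 q.2 := by
  have h : (fun q : ℝ × ℝ × ℝ => stepWeight T γ q.1 q.2) =
      {q : ℝ × ℝ × ℝ | q.1 ≤ q.2.1 ∧ q.2.1 ≤ T ∧ 0 < q.2.2 ∧ q.2.2 ≤ q.2.1}.indicator
        (fun q => ENNReal.ofReal (q.2.1 - max q.2.2 q.1) ^ (-γ)) := by
    funext q
    simp only [stepWeight, Set.indicator_apply, Set.mem_ofPred_eq]
  rw [h]
  refine Measurable.indicator (by fun_prop) ?_
  have hs : Measurable fun q : ℝ × ℝ × ℝ => q.2.2 := by fun_prop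
  have ht : Measurable fun q : ℝ × ℝ × ℝ => q.2.1 := by fun_prop
  exact (measurableSet_le measurable_fst ht).inter ((measurableSet_le ht measurable_const).inter
    ((measurableSet_lt measurable_const hs).inter (measurableSet_le hs ht)))

lemma measurable_init {n : ℕ} :
    Measurable (Fin.init : (Fin (n + 1) → ℝ × ℝ) → (Fin n → ℝ × ℝ)) :=
  measurable_pi_lambda _ fun i => measurable_pi_apply i.castSucc

lemma measurable_chainWeight (T γ : ℝ) {n : ℕ} :
    Measurable (chainWeight T γ : (Fin n → ℝ × ℝ) → ℝ≥0∞) := by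
  induction n with
  | zero => exact measurable_const
  | succ n ih =>
    exact (ih.comp measurable_init).mul ((measurable_stepWeight T γ).comp
      ((measurable_lastTime.comp measurable_init).prodMk (measurable_pi_apply (Fin.last n))))

lemma measurable_chainWeight_mul_exp (T γ c : ℝ) {n : ℕ} :
    Measurable fun x : Fin n → ℝ × ℝ =>
      chainWeight T γ x * ENNReal.ofReal (Real.exp (c * lastTime x)) :=
  (measurable_chainWeight T γ).mul (measurable_lastTime.const_mul _).exp.ennreal_ofReal

lemma stepWeight_pow {d : ℕ} (hd : d ≠ 0) (T γ r : ℝ) (p : ℝ × ℝ) :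
    stepWeight T γ r p ^ d = stepWeight T (γ * d) r p := by
  simp only [stepWeight, Set.indicator_apply]
  split_ifs
  · rw [← ENNReal.rpow_natCast, ← ENNReal.rpow_mul, neg_mul]
  · exact zero_pow hd

lemma chainWeight_pow {d : ℕ} (hd : d ≠ 0) (T γ : ℝ) {n : ℕ} (x : Fin n → ℝ × ℝ) :
    chainWeight T γ x ^ d = chainWeight T (γ * d) x := by
  induction n with
  | zero => simp [chainWeight]
  | succ n ih => simp only [chainWeight_succ, mul_pow, ih, stepWeight_pow hd]

lemma lastTime_le_of_chainWeight_ne_zero {T γ : ℝ} (hT : 0 ≤ T) {n : ℕ} {x : Fin n → ℝ × ℝ}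
    (hx : chainWeight T γ x ≠ 0) : lastTime x ≤ T := by
  cases n with
  | zero => exact hT
  | succ n =>
    have h := right_ne_zero_of_mul hx
    by_contra hlt
    refine h (Set.indicator_of_notMem (fun hmem => hlt ?_) _)
    exact hmem.2.1

lemma lintegral_ofReal_rpow_neg {γ a : ℝ} (hγ : γ < 1) (ha : 0 ≤ a) :
    ∫⁻ u in Set.Ioc 0 a, ENNReal.ofReal u ^ (-γ) = ENNReal.ofReal (a ^ (1 - γ) / (1 - γ)) := by
  have h1 : ∫⁻ u in Set.Ioc 0 a, ENNReal.ofReal u ^ (-γ) =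
      ∫⁻ u in Set.Ioc 0 a, ENNReal.ofReal (u ^ (-γ)) :=
    setLIntegral_congr_fun measurableSet_Ioc fun u hu => ENNReal.ofReal_rpow_of_pos hu.1
  have h2 : IntervalIntegrable (fun u : ℝ => u ^ (-γ)) volume 0 a :=
    intervalIntegral.intervalIntegrable_rpow' (by linarith)
  rw [h1, ← ofReal_integral_eq_lintegral_ofReal
    ((intervalIntegrable_iff_integrableOn_Ioc_of_le ha).1 h2)
    ((ae_restrict_iff' measurableSet_Ioc).2 (ae_of_all _ fun u hu => Real.rpow_nonneg hu.1.le _)),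
    ← intervalIntegral.integral_of_le ha, integral_rpow (Or.inl (by linarith)),
    show -γ + 1 = 1 - γ by ring, Real.zero_rpow (by linarith), sub_zero]

/-- For s ≤ r the weight is constant in s; for s > r it is the integrable singularity (t - s)^{-γ},
whose integral is a multiple of (t - r)^{1-γ} ≤ T (t - r)^{-γ}. -/
lemma lintegral_stepWeight_snd_le {T γ r t : ℝ} (hT : 0 < T) (hγ1 : γ < 1) (hγ0 : 0 < γ)
    (hr : 0 ≤ r) (hrt : r ≤ t) (htT : t ≤ T) :
    ∫⁻ s in Set.Ioc 0 t, ENNReal.ofReal (t - max s r) ^ (-γ) ≤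
      ENNReal.ofReal (T * (1 + 1 / (1 - γ))) * ENNReal.ofReal (t - r) ^ (-γ) := by
  have hγ' : 0 < 1 - γ := by linarith
  -- At t = r the right-hand side is infinite.
  rcases hrt.eq_or_lt with rfl | hlt
  · rw [sub_self, ENNReal.ofReal_zero, ENNReal.zero_rpow_of_neg (by linarith), ENNReal.mul_top]
    · exact le_top
    · exact (ENNReal.ofReal_pos.2 (by positivity)).ne'
  have hpos : 0 < t - r := by linarith
  rw [← Set.Ioc_union_Ioc_eq_Ioc hr hrt]
  refine (lintegral_union_le _ _ _).trans ?_
  have h1 : ∫⁻ s in Set.Ioc 0 r, ENNReal.ofReal (t - max s r) ^ (-γ) =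
      ENNReal.ofReal (t - r) ^ (-γ) * ENNReal.ofReal r := by
    rw [setLIntegral_congr_fun (g := fun _ => ENNReal.ofReal (t - r) ^ (-γ)) measurableSet_Ioc
      fun s hs => by simp only [max_eq_right hs.2]]
    simp
  have h2 : ∫⁻ s in Set.Ioc r t, ENNReal.ofReal (t - max s r) ^ (-γ) ≤
      ENNReal.ofReal ((t - r) ^ (1 - γ) / (1 - γ)) := by
    rw [← lintegral_ofReal_rpow_neg hγ1 hpos.le, setLIntegral_congr Ioo_ae_eq_Ioc.symm,
      ← lintegral_indicator measurableSet_Ioo, ← lintegral_sub_left_eq_self _ t,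
      ← lintegral_indicator measurableSet_Ioc]
    refine lintegral_mono fun u => ?_
    by_cases hu : t - u ∈ Set.Ioo r t
    · have hu' : u ∈ Set.Ioc 0 (t - r) := ⟨by linarith [hu.2], by linarith [hu.1]⟩
      rw [Set.indicator_of_mem hu, Set.indicator_of_mem hu', max_eq_left hu.1.le, sub_sub_cancel]
    · rw [Set.indicator_of_notMem hu]
      exact zero_le
  refine (add_le_add h1.le h2).trans ?_
  rw [ENNReal.ofReal_rpow_of_pos hpos, ← ENNReal.ofReal_mul (by positivity),
    ← ENNReal.ofReal_add (by positivity) (by positivity), ← ENNReal.ofReal_mul (by positivity)]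
  refine ENNReal.ofReal_le_ofReal ?_
  have h3 : (t - r) ^ (1 - γ) = (t - r) * (t - r) ^ (-γ) := by
    rw [sub_eq_add_neg 1 γ, Real.rpow_add hpos, Real.rpow_one]
  have h4 : 0 ≤ (t - r) ^ (-γ) := by positivity
  have h5 : (t - r) * (t - r) ^ (-γ) ≤ T * (t - r) ^ (-γ) :=
    mul_le_mul_of_nonneg_right (by linarith) h4
  have h6 : (t - r) ^ (-γ) * r ≤ T * (t - r) ^ (-γ) := by
    rw [mul_comm]
    exact mul_le_mul_of_nonneg_right (by linarith) h4
  calc _ ≤ T * (t - r) ^ (-γ) + T * (t - r) ^ (-γ) / (1 - γ) := by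
        rw [h3]
        gcongr
    _ = _ := by ring

lemma lintegral_exp_rpow {γ lam : ℝ} (hγ1 : γ < 1) (hlam : 0 < lam) (r : ℝ) :
    ∫⁻ t in Set.Ici r, ENNReal.ofReal (t - r) ^ (-γ) * ENNReal.ofReal (Real.exp (-lam * (t - r))) =
      ENNReal.ofReal ((1 / lam) ^ (1 - γ) * Real.Gamma (1 - γ)) := by
  have h1 : ∀ t : ℝ, (Set.Ici r).indicator (fun t => ENNReal.ofReal (t - r) ^ (-γ) *
      ENNReal.ofReal (Real.exp (-lam * (t - r)))) t =
      (Set.Ici (0 : ℝ)).indicator (fun u => ENNReal.ofReal u ^ (-γ) *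
      ENNReal.ofReal (Real.exp (-lam * u))) (t - r) := fun t => by
    simp only [Set.indicator_apply, Set.mem_Ici, sub_nonneg]
  have h2 : IntegrableOn (fun u : ℝ => u ^ (1 - γ - 1) * Real.exp (-(lam * u))) (Set.Ioi 0) := by
    have := integrableOn_rpow_mul_exp_neg_mul_rpow (p := 1) (s := 1 - γ - 1) (b := lam)
      (by linarith) one_pos hlam
    simpa [Real.rpow_one] using this
  rw [← lintegral_indicator measurableSet_Ici, lintegral_congr h1,
    lintegral_sub_right_eq_self (fun u => (Set.Ici (0 : ℝ)).indicator
      (fun u => ENNReal.ofReal u ^ (-γ) * ENNReal.ofReal (Real.exp (-lam * u))) u) r,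
    lintegral_indicator measurableSet_Ici, setLIntegral_congr Ioi_ae_eq_Ici.symm,
    ← Real.integral_rpow_mul_exp_neg_mul_Ioi (by linarith) hlam,
    ofReal_integral_eq_lintegral_ofReal h2]
  · refine setLIntegral_congr_fun measurableSet_Ioi fun u hu => ?_
    have hu0 : (0 : ℝ) < u := hu
    rw [ENNReal.ofReal_rpow_of_pos hu0, ← ENNReal.ofReal_mul (by positivity)]
    congr 3 <;> ring
  · refine (ae_restrict_iff' measurableSet_Ioi).2 (ae_of_all _ fun u hu => ?_)
    have hu0 : (0 : ℝ) < u := hu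
    positivity

/-- The integrated step weight, discounted at rate `lam`, is bounded uniformly in the starting
time. -/
lemma lintegral_stepWeight_le {T γ r lam : ℝ} (hT : 0 < T) (hγ1 : γ < 1) (hγ0 : 0 < γ)
    (hlam : 0 < lam) (hr : 0 ≤ r) :
    ∫⁻ p, stepWeight T γ r p * ENNReal.ofReal (Real.exp (-lam * (p.1 - r))) ≤
      ENNReal.ofReal (T * (1 + 1 / (1 - γ)) * ((1 / lam) ^ (1 - γ) * Real.Gamma (1 - γ))) := by
  have hmeas : Measurable fun p : ℝ × ℝ =>
      stepWeight T γ r p * ENNReal.ofReal (Real.exp (-lam * (p.1 - r))) :=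
    ((measurable_stepWeight T γ).comp (measurable_const.prodMk measurable_id)).mul (by fun_prop)
  rw [Measure.volume_eq_prod, lintegral_prod _ hmeas.aemeasurable, ENNReal.ofReal_mul
    (by have : 0 < 1 - γ := by linarith
        positivity), ← lintegral_exp_rpow hγ1 hlam r, ← lintegral_const_mul _ (by fun_prop),
    ← lintegral_indicator measurableSet_Ici]
  refine lintegral_mono fun t => ?_
  by_cases ht : r ≤ t ∧ t ≤ T
  · rw [Set.indicator_of_mem (Set.mem_Ici.2 ht.1), ← mul_assoc]
    have hmeas' : Measurable fun s => stepWeight T γ r (t, s) := (measurable_stepWeight T γ).comp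
      (measurable_const.prodMk (measurable_const.prodMk measurable_id))
    change ∫⁻ s, stepWeight T γ r (t, s) * ENNReal.ofReal (Real.exp (-lam * (t - r))) ≤ _
    rw [lintegral_mul_const _ hmeas']
    refine mul_le_mul_left ?_ _
    refine le_trans (le_of_eq ?_) (lintegral_stepWeight_snd_le hT hγ1 hγ0 hr ht.1 ht.2)
    rw [← lintegral_indicator measurableSet_Ioc]
    refine lintegral_congr fun s => ?_
    simp only [stepWeight, Set.indicator_apply, Set.mem_ofPred_eq, Set.mem_Ioc, ht.1, ht.2,
      true_and]
  · have : ∀ s, stepWeight T γ r (t, s) = 0 := fun s =>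
      Set.indicator_of_notMem (fun h => ht ⟨h.1, h.2.1⟩) _
    simp [this]

lemma zero_le_lastTime_of_chainWeight_ne_zero {T γ : ℝ} {n : ℕ} {x : Fin n → ℝ × ℝ}
    (hx : chainWeight T γ x ≠ 0) : 0 ≤ lastTime x := by
  cases n with
  | zero => exact le_rfl
  | succ n =>
    have h := right_ne_zero_of_mul hx
    by_contra hlt
    refine h (Set.indicator_of_notMem (fun hmem => hlt ?_) _)
    exact (hmem.2.2.1.trans_le hmem.2.2.2).le

/-- Discounting the last time makes the one-step bound uniform in the starting time, so the estimate
iterates without computing nested Beta integrals. -/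
lemma lintegral_chainWeight_exp_le {T γ lam : ℝ} (hT : 0 < T) (hγ1 : γ < 1) (hγ0 : 0 < γ)
    (hlam : 0 < lam) (n : ℕ) :
    ∫⁻ x : Fin n → ℝ × ℝ, chainWeight T γ x * ENNReal.ofReal (Real.exp (-lam * lastTime x)) ≤
      ENNReal.ofReal (T * (1 + 1 / (1 - γ)) * ((1 / lam) ^ (1 - γ) * Real.Gamma (1 - γ))) ^ n := by
  induction n with
  | zero =>
    rw [pow_zero]
    -- The value 0 of `lastTime` on the empty sequence makes the initial discount equal to 1.
    simp [chainWeight, lastTime, volume_pi]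
  | succ n ih =>
    set κ := ENNReal.ofReal (T * (1 + 1 / (1 - γ)) * ((1 / lam) ^ (1 - γ) * Real.Gamma (1 - γ)))
    have hmp := (volume_preserving_piFinSuccAbove (fun _ : Fin (n + 1) => ℝ × ℝ)
      (Fin.last n)).symm
    have hF : Measurable fun x : Fin (n + 1) → ℝ × ℝ =>
        chainWeight T γ x * ENNReal.ofReal (Real.exp (-lam * lastTime x)) :=
      measurable_chainWeight_mul_exp T γ (-lam)
    rw [← hmp.lintegral_comp hF, Measure.volume_eq_prod,
      lintegral_prod_symm _ (by exact (hF.comp hmp.measurable).aemeasurable)]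
    calc _ ≤ ∫⁻ y : Fin n → ℝ × ℝ, chainWeight T γ y *
          ENNReal.ofReal (Real.exp (-lam * lastTime y)) * κ := by
          refine lintegral_mono fun y => ?_
          have hy : ∀ p : ℝ × ℝ, Fin.init ((MeasurableEquiv.piFinSuccAbove
              (fun _ : Fin (n + 1) => ℝ × ℝ) (Fin.last n)).symm (p, y)) = y := fun p => by
            funext k
            simp [MeasurableEquiv.piFinSuccAbove_symm_apply, Fin.insertNthEquiv, Fin.init]
          have hp : ∀ p : ℝ × ℝ, (MeasurableEquiv.piFinSuccAbove
              (fun _ : Fin (n + 1) => ℝ × ℝ) (Fin.last n)).symm (p, y) (Fin.last n) = p :=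
            fun p => by
            simp [MeasurableEquiv.piFinSuccAbove_symm_apply, Fin.insertNthEquiv]
          simp only [chainWeight_succ, lastTime_succ, hy, hp]
          by_cases h0 : chainWeight T γ y = 0
          · simp [h0]
          have hstep := lintegral_stepWeight_le hT hγ1 hγ0 hlam
            (zero_le_lastTime_of_chainWeight_ne_zero h0)
          refine le_trans (le_of_eq ?_) (mul_le_mul_right hstep _)
          have hm : Measurable fun p : ℝ × ℝ => stepWeight T γ (lastTime y) p *
              ENNReal.ofReal (Real.exp (-lam * (p.1 - lastTime y))) :=
            ((measurable_stepWeight T γ).comp (measurable_const.prodMk measurable_id)).mul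
              (by fun_prop)
          rw [← lintegral_const_mul _ hm]
          refine lintegral_congr fun p => ?_
          -- The discount splits along the chain, leaving one factor for the past and one for the
          -- new increment of time.
          have he : ENNReal.ofReal (Real.exp (-lam * p.1)) =
              ENNReal.ofReal (Real.exp (-lam * lastTime y)) *
                ENNReal.ofReal (Real.exp (-lam * (p.1 - lastTime y))) := by
            rw [← ENNReal.ofReal_mul (Real.exp_nonneg _), ← Real.exp_add]
            congr 2
            ring
          rw [he]
          ring
      _ ≤ _ := by
          rw [lintegral_mul_const _ (measurable_chainWeight_mul_exp T γ (-lam)), pow_succ]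
          exact mul_le_mul_left ih _

/-- On the support the last time is at most `T`, so the discount can be undone at the cost of
e^{λT}. -/
lemma lintegral_chainWeight_le {T γ lam : ℝ} (hT : 0 < T) (hγ1 : γ < 1) (hγ0 : 0 < γ)
    (hlam : 0 < lam) (n : ℕ) :
    ∫⁻ x : Fin n → ℝ × ℝ, chainWeight T γ x ≤ ENNReal.ofReal (Real.exp (lam * T)) *
      ENNReal.ofReal (T * (1 + 1 / (1 - γ)) * ((1 / lam) ^ (1 - γ) * Real.Gamma (1 - γ))) ^ n := by
  refine le_trans ?_ (mul_le_mul_right (lintegral_chainWeight_exp_le hT hγ1 hγ0 hlam n) _)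
  rw [← lintegral_const_mul _ (measurable_chainWeight_mul_exp T γ (-lam))]
  refine lintegral_mono fun x => ?_
  by_cases h0 : chainWeight T γ x = 0
  · simp [h0]
  have h1 := lastTime_le_of_chainWeight_ne_zero hT.le h0
  calc chainWeight T γ x = chainWeight T γ x * 1 := (mul_one _).symm
    _ ≤ chainWeight T γ x * (ENNReal.ofReal (Real.exp (lam * T)) *
        ENNReal.ofReal (Real.exp (-lam * lastTime x))) := by
        gcongr
        rw [← ENNReal.ofReal_mul (Real.exp_nonneg _), ← Real.exp_add, ← ENNReal.ofReal_one]
        refine ENNReal.ofReal_le_ofReal (Real.one_le_exp ?_)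
        nlinarith
    _ = _ := by ring

/-- A choice of the discount rate gives the factorial decay of the integrated chain weight. -/
lemma factorial_mul_lintegral_chainWeight_le {T γ : ℝ} (hT : 0 < T) (hγ1 : γ < 1) (hγ0 : 0 < γ)
    {n : ℕ} (hn : 1 ≤ n) :
    (n.factorial : ℝ≥0∞) * ∫⁻ x : Fin n → ℝ × ℝ, chainWeight T γ x ≤
      ENNReal.ofReal ((Real.exp 1 * (T * (1 + 1 / (1 - γ)) *
        (T ^ (1 - γ) * Real.Gamma (1 - γ)))) ^ n * (n.factorial : ℝ) ^ γ) := by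
  have hγ' : 0 < 1 - γ := by linarith
  have hΓ := Real.Gamma_pos_of_pos hγ'
  have hn0 : (0 : ℝ) < n := by exact_mod_cast hn
  have hf0 : (0 : ℝ) < n.factorial := by exact_mod_cast n.factorial_pos
  -- The rate n/T makes the cost e^n and produces n^{-(1-γ)n}, which is at most (n!)^{-(1-γ)}
  -- because n! ≤ n^n.
  refine (mul_le_mul_right (lintegral_chainWeight_le hT hγ1 hγ0 (div_pos hn0 hT) n) _).trans ?_
  rw [← ENNReal.ofReal_natCast, ← ENNReal.ofReal_pow (by positivity),
    ← ENNReal.ofReal_mul (by positivity), ← ENNReal.ofReal_mul (by positivity)]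
  refine ENNReal.ofReal_le_ofReal ?_
  have h1 : Real.exp (n / T * T) = Real.exp 1 ^ n := by
    rw [div_mul_cancel₀ _ hT.ne', ← Real.exp_nat_mul, mul_one]
  have h2 : (1 / (n / T)) ^ (1 - γ) = T ^ (1 - γ) * (n : ℝ) ^ (-(1 - γ)) := by
    rw [one_div_div, Real.div_rpow hT.le hn0.le, Real.rpow_neg hn0.le, div_eq_mul_inv]
  have h3 : ((n : ℝ) ^ (-(1 - γ))) ^ n ≤ (n.factorial : ℝ) ^ (-(1 - γ)) := by
    rw [← Real.rpow_natCast, ← Real.rpow_mul hn0.le, mul_comm, Real.rpow_mul hn0.le,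
      Real.rpow_natCast]
    refine Real.rpow_le_rpow_of_nonpos hf0 ?_ (by linarith)
    exact_mod_cast Nat.factorial_le_pow n
  have h4 : (n.factorial : ℝ) * (n.factorial : ℝ) ^ (-(1 - γ)) = (n.factorial : ℝ) ^ γ := by
    rw [← Real.rpow_one_add' hf0.le (by linarith)]
    congr 1
    ring
  calc _ = (Real.exp 1 * (T * (1 + 1 / (1 - γ)) * (T ^ (1 - γ) * Real.Gamma (1 - γ)))) ^ n *
        (n.factorial * ((n : ℝ) ^ (-(1 - γ))) ^ n) := by
        rw [h1, h2]
        generalize 1 + 1 / (1 - γ) = a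
        ring
    _ ≤ (Real.exp 1 * (T * (1 + 1 / (1 - γ)) * (T ^ (1 - γ) * Real.Gamma (1 - γ)))) ^ n *
        (n.factorial * (n.factorial : ℝ) ^ (-(1 - γ))) := by gcongr
    _ = _ := by rw [h4]

/-- The integral of a symmetric function is at most `n!` times its integral over the set where
a given key is sorted. -/
lemma lintegral_le_factorial_mul_sorted {α : Type*} [MeasureSpace α]
    [SigmaFinite (volume : Measure α)] {n : ℕ} {F : (Fin n → α) → ℝ≥0∞} (hF : Measurable F)
    (hsymm : ∀ (σ : Equiv.Perm (Fin n)) x, F (x ∘ σ) = F x) {key : α → ℝ} (hkey : Measurable key) :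
    ∫⁻ x, F x ≤ n.factorial * ∫⁻ x, {x | Monotone (key ∘ x)}.indicator F x := by
  have hset : MeasurableSet {x : Fin n → α | Monotone (key ∘ x)} := by
    have : {x : Fin n → α | Monotone (key ∘ x)} =
        ⋂ i, ⋂ j, ⋂ _ : i ≤ j, {x | key (x i) ≤ key (x j)} := by
      ext x
      simp [Monotone]
    rw [this]
    exact MeasurableSet.iInter fun i => MeasurableSet.iInter fun j => MeasurableSet.iInter fun _ =>
      measurableSet_le (hkey.comp (measurable_pi_apply i)) (hkey.comp (measurable_pi_apply j))
  have hG := hF.indicator hset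
  have hperm : ∀ σ : Equiv.Perm (Fin n), MeasurePreserving (fun x : Fin n → α => x ∘ σ) := by
    intro σ
    have h := volume_measurePreserving_piCongrLeft (fun _ : Fin n => α) σ.symm
    have heq : (fun x : Fin n → α => x ∘ σ) =
        MeasurableEquiv.piCongrLeft (fun _ : Fin n => α) σ.symm := by
      funext x k
      have := MeasurableEquiv.piCongrLeft_apply_apply (β := fun _ : Fin n => α) σ.symm x (σ k)
      simpa using this.symm
    rw [heq]
    exact h
  calc ∫⁻ x, F x ≤ ∫⁻ x, ∑ σ : Equiv.Perm (Fin n),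
        {x | Monotone (key ∘ x)}.indicator F (x ∘ σ) := by
        refine lintegral_mono fun x => ?_
        -- Some permutation sorts the keys, so one term of the sum over permutations already equals
        -- `F x`; ties cause only overcounting.
        have hm : (x ∘ Tuple.sort (key ∘ x)) ∈ {x : Fin n → α | Monotone (key ∘ x)} :=
          Tuple.monotone_sort (key ∘ x)
        calc F x = {x | Monotone (key ∘ x)}.indicator F (x ∘ Tuple.sort (key ∘ x)) := by
              rw [Set.indicator_of_mem hm, hsymm]
          _ ≤ _ := Finset.single_le_sum (f := fun σ : Equiv.Perm (Fin n) =>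
              {x | Monotone (key ∘ x)}.indicator F (x ∘ σ)) (fun _ _ => zero_le)
              (Finset.mem_univ _)
    _ = _ := by
        rw [lintegral_finsetSum _ fun σ _ => by exact hG.comp (hperm σ).measurable]
        rw [Finset.sum_congr rfl fun σ _ => (hperm σ).lintegral_comp hG]
        simp [Fintype.card_perm]

end Chain

/-! ### Local nondeterminism and the resulting bound on Gaussian integrals. -/

section LocalNondeterminism

variable {E : Type*} [NormedAddCommGroup E] [InnerProductSpace ℝ E]

/-- Local nondeterminism of a Hilbert space valued curve: for `r < t ≤ T` the vector `h t` has a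
component orthogonal to the past up to time `r` of squared norm at least `k₁ (t - r)^{2H}`. -/
def IsLocallyNondeterministic (h : ℝ≥0 → E) (T H k₁ : ℝ) : Prop :=
  ∀ r t : ℝ≥0, r < t → (t : ℝ) ≤ T → ∃ w : E, (∀ u ≤ r, ⟪h u, w⟫ = 0) ∧ ⟪h t - w, w⟫ = 0 ∧
    k₁ * ((t : ℝ) - r) ^ (2 * H) ≤ ‖w‖ ^ 2

/-- The pairs of times `(t, s)` with `0 < s ≤ t ≤ T`. -/
def timeSimplex (T : ℝ) : Set (ℝ × ℝ) := {p | 0 < p.2 ∧ p.2 ≤ p.1 ∧ p.1 ≤ T}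

/-- The increment of the curve `h` between the two times of a pair. -/
def increment (h : ℝ≥0 → E) (p : ℝ × ℝ) : E := h p.1.toNNReal - h p.2.toNNReal

/-- The constant produced by a one-dimensional Gaussian integration. -/
def stepConst (k₁ : ℝ) : ℝ := (2 * Real.pi)⁻¹ * (Real.sqrt (2 * Real.pi) * (Real.sqrt k₁)⁻¹)

lemma stepConst_pos {k₁ : ℝ} (hk₁ : 0 < k₁) : 0 < stepConst k₁ := by
  unfold stepConst
  positivity

/-- Induction on the number of pairs in order of t: each new increment has a component independent
of all earlier ones, and integrating out its frequency yields one step weight. -/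
lemma gaussianIntegral_le_chainWeight {h : ℝ≥0 → E} {T H k₁ : ℝ} (hk₁ : 0 < k₁) (hH : 0 < H)
    (hloc : IsLocallyNondeterministic h T H k₁) {n : ℕ} (x : Fin n → ℝ × ℝ)
    (hx : ∀ k, x k ∈ timeSimplex T) (hmono : Monotone fun k => (x k).1) :
    ENNReal.ofReal ((2 * Real.pi)⁻¹) ^ n * gaussianIntegral (fun k => increment h (x k)) ≤
      ENNReal.ofReal (stepConst k₁) ^ n * chainWeight T H x := by
  induction n with
  | zero => simp [chainWeight, gaussianIntegral, volume_pi]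
  | succ n ih =>
    have hih := ih (Fin.init x) (fun k => hx _)
      (fun i j hij => hmono (Fin.castSucc_le_castSucc_iff.2 hij))
    obtain ⟨hs0, hst, htT⟩ := hx (Fin.last n)
    set t := (x (Fin.last n)).1 with ht
    set s := (x (Fin.last n)).2 with hs
    set r₀ := lastTime (Fin.init x) with hr₀
    have hr₀t : r₀ ≤ t := by
      cases n with
      | zero => exact hs0.le.trans hst
      | succ m => exact hmono (Fin.le_last _)
    have hpast : ∀ k : Fin n, (x k.castSucc).1 ≤ r₀ := by
      cases n with
      | zero => exact fun k => k.elim0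
      | succ m => exact fun k => hmono (Fin.castSucc_le_castSucc_iff.2 (Fin.le_last k))
    have hstep : stepWeight T H r₀ (x (Fin.last n)) = ENNReal.ofReal (t - max s r₀) ^ (-H) :=
      Set.indicator_of_mem
        (show x (Fin.last n) ∈ {p : ℝ × ℝ | r₀ ≤ p.1 ∧ p.1 ≤ T ∧ 0 < p.2 ∧ p.2 ≤ p.1} from
          ⟨hr₀t, htT, hs0, hst⟩) _
    have hfactor : gaussianIntegral (fun k => increment h (x k)) ≤
        gaussianIntegral (fun k : Fin n => increment h (Fin.init x k)) *
          (ENNReal.ofReal (Real.sqrt (2 * Real.pi) * (Real.sqrt k₁)⁻¹) *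
            ENNReal.ofReal (t - max s r₀) ^ (-H)) := by
      -- If no time separates t from its past, the weight is 0^{-H} = ∞ and the bound is trivial.
      rcases (max_le hst hr₀t).eq_or_lt with heq | hlt
      · rw [heq, sub_self, ENNReal.ofReal_zero, ENNReal.zero_rpow_of_neg (by linarith),
          ENNReal.mul_top (ENNReal.ofReal_pos.2 (by positivity)).ne',
          ENNReal.mul_top (gaussianIntegral_ne_zero _)]
        exact le_top
      · have hr0 : 0 < max s r₀ := hs0.trans_le (le_max_left _ _)
        have ht0 : 0 < t := hr0.trans hlt
        -- The past is taken up to max(s, r₀), so that `w` is orthogonal both to the earlier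
        -- increments and to the subtracted value h(s).
        obtain ⟨w, hw1, hw2, hw3⟩ := hloc (max s r₀).toNNReal t.toNNReal
          ((Real.toNNReal_lt_toNNReal_iff ht0).2 hlt) (by rwa [Real.coe_toNNReal _ ht0.le])
        rw [Real.coe_toNNReal _ ht0.le, Real.coe_toNNReal _ hr0.le] at hw3
        have hδ : 0 < t - max s r₀ := by linarith
        have hpast' : ∀ u : ℝ, u ≤ max s r₀ → ⟪h u.toNNReal, w⟫ = 0 := fun u hu =>
          hw1 _ (Real.toNNReal_le_toNNReal hu)
        refine (gaussianIntegral_succ_le _ w ?_ ?_).trans (mul_le_mul_right ?_ _)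
        · intro k
          have h1 : (x k.castSucc).1 ≤ max s r₀ := (hpast k).trans (le_max_right _ _)
          rw [increment, inner_sub_left, hpast' _ h1, hpast' _ ((hx _).2.1.trans h1), sub_zero]
        · rw [increment, sub_right_comm, inner_sub_left, hw2, hpast' _ (le_max_left _ _), sub_zero]
        · set a := Real.sqrt k₁ * (t - max s r₀) ^ H with ha
          have ha0 : 0 < a := by positivity
          have ha2 : a ^ 2 ≤ ‖w‖ ^ 2 := by
            rw [ha, mul_pow, Real.sq_sqrt hk₁.le, ← Real.rpow_natCast (_ ^ H),
              ← Real.rpow_mul hδ.le, mul_comm H]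
            exact_mod_cast hw3
          calc _ ≤ ∫⁻ y : ℝ, ENNReal.ofReal (Real.exp (-(a ^ 2 / 2) * y ^ 2)) := by
                refine lintegral_mono fun y => ENNReal.ofReal_le_ofReal (Real.exp_le_exp.2 ?_)
                have := mul_le_mul_of_nonneg_right ha2 (sq_nonneg y)
                linarith
            _ = _ := by
                rw [lintegral_gaussian ha0, ENNReal.ofReal_rpow_of_pos hδ,
                  ← ENNReal.ofReal_mul (by positivity), ha, mul_inv, Real.rpow_neg hδ.le, mul_assoc]
    rw [chainWeight_succ, hstep, pow_succ, pow_succ]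
    calc _ ≤ ENNReal.ofReal ((2 * Real.pi)⁻¹) ^ n * ENNReal.ofReal ((2 * Real.pi)⁻¹) *
          (gaussianIntegral (fun k : Fin n => increment h (Fin.init x k)) *
          (ENNReal.ofReal (Real.sqrt (2 * Real.pi) * (Real.sqrt k₁)⁻¹) *
            ENNReal.ofReal (t - max s r₀) ^ (-H))) := mul_le_mul_right hfactor _
      _ = (ENNReal.ofReal ((2 * Real.pi)⁻¹) ^ n *
          gaussianIntegral (fun k : Fin n => increment h (Fin.init x k))) *
          (ENNReal.ofReal ((2 * Real.pi)⁻¹) *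
            ENNReal.ofReal (Real.sqrt (2 * Real.pi) * (Real.sqrt k₁)⁻¹)) *
            ENNReal.ofReal (t - max s r₀) ^ (-H) := by ring
      _ ≤ ENNReal.ofReal (stepConst k₁) ^ n * chainWeight T H (Fin.init x) *
          ENNReal.ofReal (stepConst k₁) * ENNReal.ofReal (t - max s r₀) ^ (-H) := by
          rw [← ENNReal.ofReal_mul (by positivity), ← stepConst]
          gcongr
      _ = _ := by ring

lemma ofReal_regGaussian_pow_le {h : ℝ≥0 → E} {T H k₁ : ℝ} (hk₁ : 0 < k₁) (hH : 0 < H)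
    (hloc : IsLocallyNondeterministic h T H k₁) {d : ℕ} (hd : d ≠ 0) {n : ℕ} {ε : Fin n → ℝ}
    (hε : ∀ k, 0 < ε k) (x : Fin n → ℝ × ℝ)
    (hx : ∀ k, x k ∈ timeSimplex T) (hmono : Monotone fun k => (x k).1) :
    ENNReal.ofReal (regGaussian ε (fun k => increment h (x k)) ^ d) ≤
      ENNReal.ofReal (stepConst k₁ ^ d) ^ n * chainWeight T (H * d) x := by
  rw [ENNReal.ofReal_pow (regGaussian_nonneg _ _), ENNReal.ofReal_pow (stepConst_pos hk₁).le,
    ← chainWeight_pow hd, ← pow_mul, mul_comm d n, pow_mul, ← mul_pow]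
  gcongr
  exact (ofReal_regGaussian_le hε _).trans (gaussianIntegral_le_chainWeight hk₁ hH hloc x hx hmono)

end LocalNondeterminism

/-! ### Moments of the approximate local times. -/

section Moments

variable {Ω : Type*} [MeasurableSpace Ω] {P : Measure Ω} {d : ℕ}
  {B : ℝ≥0 → Ω → EuclideanSpace ℝ (Fin d)} {T : ℝ}
  {E : Type*} [NormedAddCommGroup E] [InnerProductSpace ℝ E]

/-- The increments of `B` are centred Gaussian with independent coordinates and covariance given by
the Hilbert space valued curve `h`. -/
def HasGaussianIncrements (B : ℝ≥0 → Ω → EuclideanSpace ℝ (Fin d)) (P : Measure Ω)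
    (h : ℝ≥0 → E) : Prop :=
  ∀ (n : ℕ) (s t : Fin n → ℝ≥0) (ξ : Fin d → Fin n → ℝ),
    ∫ ω, Complex.exp ((∑ j, ∑ k, ξ j k * (B (t k) ω j - B (s k) ω j) : ℝ) * Complex.I) ∂P =
      ((Real.exp (-(∑ j, ‖∑ k, ξ j k • (h (t k) - h (s k))‖ ^ 2) / 2) : ℝ) : ℂ)

/-- The integrand of the approximate local time, extended by zero off the time simplex. -/
def crossing (B : ℝ≥0 → Ω → EuclideanSpace ℝ (Fin d)) (T ε : ℝ) (p : ℝ × ℝ) (ω : Ω) : ℝ :=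
  (timeSimplex T).indicator
    (fun p => heatKernel ε (B p.1.toNNReal ω - B p.2.toNNReal ω)) p

lemma measurableSet_timeSimplex (T : ℝ) : MeasurableSet (timeSimplex T) :=
  (measurableSet_lt measurable_const measurable_snd).inter
    ((measurableSet_le measurable_snd measurable_fst).inter
      (measurableSet_le measurable_fst measurable_const))

lemma volume_timeSimplex_ne_top (T : ℝ) : volume (timeSimplex T) ≠ ∞ := by
  refine ((measure_mono (t := Set.Icc (0 : ℝ) T ×ˢ Set.Icc (0 : ℝ) T) ?_).trans_lt ?_).ne
  · rintro p ⟨h1, h2, h3⟩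
    exact ⟨⟨h1.le.trans h2, h3⟩, ⟨h1.le, h2.trans h3⟩⟩
  · exact (isCompact_Icc.prod isCompact_Icc).measure_lt_top

lemma crossing_nonneg {Ω : Type*} {B : ℝ≥0 → Ω → EuclideanSpace ℝ (Fin d)} {ε : ℝ} (hε : 0 < ε)
    (p : ℝ × ℝ) (ω : Ω) :
    0 ≤ crossing B T ε p ω :=
  Set.indicator_nonneg (fun _ _ => heatKernel_nonneg hε _) _

lemma crossing_le {Ω : Type*} {B : ℝ≥0 → Ω → EuclideanSpace ℝ (Fin d)} {ε : ℝ} (hε : 0 < ε)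
    (p : ℝ × ℝ) (ω : Ω) :
    crossing B T ε p ω ≤
      (timeSimplex T).indicator (fun _ => (2 * Real.pi * ε) ^ (-(d : ℝ) / 2)) p :=
  Set.indicator_le_indicator (heatKernel_le hε _)

lemma measurable_crossing (hB : Measurable fun q : ℝ≥0 × Ω => B q.1 q.2) (ε : ℝ) :
    Measurable fun q : (ℝ × ℝ) × Ω => crossing B T ε q.1 q.2 := by
  have h1 : Measurable fun q : (ℝ × ℝ) × Ω =>
      heatKernel ε (B q.1.1.toNNReal q.2 - B q.1.2.toNNReal q.2) := by
    refine (continuous_heatKernel ε).measurable.comp (Measurable.sub ?_ ?_)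
    · exact hB.comp (measurable_fst.fst.real_toNNReal.prodMk measurable_snd)
    · exact hB.comp (measurable_fst.snd.real_toNNReal.prodMk measurable_snd)
  exact h1.indicator (measurable_fst (measurableSet_timeSimplex T))

lemma integrable_bound (T c : ℝ) :
    Integrable ((timeSimplex T).indicator fun _ => c : ℝ × ℝ → ℝ) :=
  (integrable_indicator_iff (measurableSet_timeSimplex T)).2
    (integrableOn_const (volume_timeSimplex_ne_top T))

lemma integrable_crossing (hB : Measurable fun q : ℝ≥0 × Ω => B q.1 q.2) {ε : ℝ} (hε : 0 < ε)
    (ω : Ω) : Integrable fun p => crossing B T ε p ω := by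
  refine (integrable_bound T ((2 * Real.pi * ε) ^ (-(d : ℝ) / 2))).mono'
    ((measurable_crossing hB ε).comp (measurable_id.prodMk measurable_const)).aestronglyMeasurable
    (ae_of_all _ fun p => ?_)
  rw [Real.norm_of_nonneg (crossing_nonneg hε _ _)]
  exact crossing_le hε p ω

lemma approxLocalTime_eq_integral (hB : Measurable fun q : ℝ≥0 × Ω => B q.1 q.2) (hT : 0 ≤ T)
    {ε : ℝ} (hε : 0 < ε) (ω : Ω) :
    approxLocalTime B T ε ω = ∫ p, crossing B T ε p ω := by
  have hint := integrable_crossing (T := T) hB hε ω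
  rw [Measure.volume_eq_prod] at hint ⊢
  rw [integral_prod _ hint, approxLocalTime, intervalIntegral.integral_of_le hT,
    ← integral_indicator measurableSet_Ioc]
  refine integral_congr_ae (ae_of_all _ fun t => ?_)
  by_cases ht : t ∈ Set.Ioc 0 T
  · simp only [Set.indicator_of_mem ht]
    rw [intervalIntegral.integral_of_le ht.1.le, ← integral_indicator measurableSet_Ioc]
    refine integral_congr_ae (ae_of_all _ fun s => ?_)
    simp only [crossing, Set.indicator_apply, timeSimplex, Set.mem_ofPred_eq, Set.mem_Ioc, ht.2,
      and_true]
  · simp only [Set.indicator_of_notMem ht]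
    have : ∀ s, crossing B T ε (t, s) ω = 0 := fun s => by
      refine Set.indicator_of_notMem (fun h => ht ⟨h.1.trans_le h.2.1, h.2.2⟩) _
    simp [this]

lemma approxLocalTime_nonneg (hB : Measurable fun q : ℝ≥0 × Ω => B q.1 q.2) (hT : 0 ≤ T)
    {ε : ℝ} (hε : 0 < ε) (ω : Ω) : 0 ≤ approxLocalTime B T ε ω := by
  rw [approxLocalTime_eq_integral hB hT hε]
  exact integral_nonneg fun p => crossing_nonneg hε p ω

lemma measurable_prod_crossing (hB : Measurable fun q : ℝ≥0 × Ω => B q.1 q.2) {n : ℕ}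
    (ε : Fin n → ℝ) :
    Measurable fun q : (Fin n → ℝ × ℝ) × Ω => ∏ k, crossing B T (ε k) (q.1 k) q.2 := by
  have h2 : ∀ k, Measurable fun q : (Fin n → ℝ × ℝ) × Ω => crossing B T (ε k) (q.1 k) q.2 := by
    intro k
    have h0 : Measurable fun q : (ℝ × ℝ) × Ω => crossing B T (ε k) q.1 q.2 :=
      measurable_crossing hB (ε k)
    have h1 : Measurable fun q : (Fin n → ℝ × ℝ) × Ω => (q.1 k, q.2) := by fun_prop
    generalize crossing B T (ε k) = f at h0 ⊢
    exact h0.comp h1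
  exact Finset.measurable_fun_prod _ fun k _ => h2 k

lemma integrable_prod_crossing [IsProbabilityMeasure P]
    (hB : Measurable fun q : ℝ≥0 × Ω => B q.1 q.2) {n : ℕ} {ε : Fin n → ℝ} (hε : ∀ k, 0 < ε k) :
    Integrable (fun q : (Fin n → ℝ × ℝ) × Ω => ∏ k, crossing B T (ε k) (q.1 k) q.2)
      (volume.prod P) := by
  have hbound : Integrable fun x : Fin n → ℝ × ℝ =>
      ∏ k, (timeSimplex T).indicator (fun _ => (2 * Real.pi * ε k) ^ (-(d : ℝ) / 2)) (x k) :=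
    Integrable.fintype_prod fun k => integrable_bound T _
  refine (hbound.mul_prod (integrable_const (μ := P) (1 : ℝ))).mono'
    (measurable_prod_crossing hB ε).aestronglyMeasurable (ae_of_all _ fun q => ?_)
  · rw [Real.norm_of_nonneg (Finset.prod_nonneg fun k _ => crossing_nonneg (hε k) _ _), mul_one]
    exact Finset.prod_le_prod (fun k _ => crossing_nonneg (hε k) _ _)
      fun k _ => crossing_le (hε k) _ _

lemma prod_approxLocalTime (hB : Measurable fun q : ℝ≥0 × Ω => B q.1 q.2) (hT : 0 ≤ T)
    {n : ℕ} {ε : Fin n → ℝ} (hε : ∀ k, 0 < ε k) (ω : Ω) :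
    ∏ k, approxLocalTime B T (ε k) ω =
      ∫ x : Fin n → ℝ × ℝ, ∏ k, crossing B T (ε k) (x k) ω := by
  rw [Finset.prod_congr rfl fun k _ => approxLocalTime_eq_integral hB hT (hε k) ω]
  exact (integral_fintype_prod_volume_eq_prod fun k p => crossing B T (ε k) p ω).symm

lemma integrable_prod_approxLocalTime [IsProbabilityMeasure P]
    (hB : Measurable fun q : ℝ≥0 × Ω => B q.1 q.2) (hT : 0 ≤ T)
    {n : ℕ} {ε : Fin n → ℝ} (hε : ∀ k, 0 < ε k) :
    Integrable (fun ω => ∏ k, approxLocalTime B T (ε k) ω) P := by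
  simp_rw [prod_approxLocalTime hB hT hε]
  exact (integrable_prod_crossing hB hε).integral_prod_right

lemma integral_prod_approxLocalTime [IsProbabilityMeasure P]
    (hB : Measurable fun q : ℝ≥0 × Ω => B q.1 q.2) (hT : 0 ≤ T)
    {n : ℕ} {ε : Fin n → ℝ} (hε : ∀ k, 0 < ε k) :
    ∫ ω, ∏ k, approxLocalTime B T (ε k) ω ∂P =
      ∫ x : Fin n → ℝ × ℝ, ∫ ω, ∏ k, crossing B T (ε k) (x k) ω ∂P := by
  simp_rw [prod_approxLocalTime hB hT hε]
  exact (integral_integral_swap (f := fun (x : Fin n → ℝ × ℝ) ω =>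
    ∏ k, crossing B T (ε k) (x k) ω) (integrable_prod_crossing hB hε)).symm

lemma integral_prod_crossing [IsProbabilityMeasure P]
    (hB : Measurable fun q : ℝ≥0 × Ω => B q.1 q.2) {h : ℝ≥0 → E}
    (hG : HasGaussianIncrements B P h) {n : ℕ} {ε : Fin n → ℝ} (hε : ∀ k, 0 < ε k)
    (x : Fin n → ℝ × ℝ) :
    ∫ ω, ∏ k, crossing B T (ε k) (x k) ω ∂P =
      {x : Fin n → ℝ × ℝ | ∀ k, x k ∈ timeSimplex T}.indicator
        (fun x => regGaussian ε (fun k => increment h (x k)) ^ d) x := by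
  by_cases hx : ∀ k, x k ∈ timeSimplex T
  · rw [Set.indicator_of_mem (by exact hx)]
    have hBm : ∀ t, Measurable (B t) := fun t => hB.comp measurable_prodMk_left
    rw [← integral_prod_heatKernel (P := P)
      (Z := fun k ω => B (x k).1.toNNReal ω - B (x k).2.toNNReal ω)
      (fun k => (hBm _).sub (hBm _)) (g := fun k => increment h (x k))
      (fun ξ => hG n (fun k => (x k).2.toNNReal) (fun k => (x k).1.toNNReal) ξ) hε]
    refine integral_congr_ae (ae_of_all _ fun ω => ?_)
    exact Finset.prod_congr rfl fun k _ => Set.indicator_of_mem (hx k) _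
  · rw [Set.indicator_of_notMem (by exact hx)]
    obtain ⟨k, hk⟩ := not_forall.1 hx
    have : ∀ ω, ∏ k, crossing B T (ε k) (x k) ω = 0 := fun ω =>
      Finset.prod_eq_zero (Finset.mem_univ k) (Set.indicator_of_notMem hk _)
    simp [this]

/-- Mixed moments of the approximate local times decrease in the regularisation parameters. -/
lemma integral_prod_approxLocalTime_anti [IsProbabilityMeasure P]
    (hB : Measurable fun q : ℝ≥0 × Ω => B q.1 q.2) (hT : 0 ≤ T) {h : ℝ≥0 → E}
    (hG : HasGaussianIncrements B P h) {n : ℕ} {ε η : Fin n → ℝ} (hε : ∀ k, 0 < ε k)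
    (hεη : ∀ k, ε k ≤ η k) :
    ∫ ω, ∏ k, approxLocalTime B T (η k) ω ∂P ≤ ∫ ω, ∏ k, approxLocalTime B T (ε k) ω ∂P := by
  have hη : ∀ k, 0 < η k := fun k => (hε k).trans_le (hεη k)
  rw [integral_prod_approxLocalTime hB hT hε, integral_prod_approxLocalTime hB hT hη]
  refine integral_mono (integrable_prod_crossing hB hη).integral_prod_left
    (integrable_prod_crossing hB hε).integral_prod_left fun x => ?_
  simp only
  rw [integral_prod_crossing hB hG hε, integral_prod_crossing hB hG hη]
  exact Set.indicator_le_indicator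
    (pow_le_pow_left₀ (regGaussian_nonneg _ _) (regGaussian_anti hε hεη _) d)

/-- The constant in the moment bound. -/
def momentConst (d : ℕ) (T H k₁ : ℝ) : ℝ :=
  stepConst k₁ ^ d * (Real.exp 1 * (T * (1 + 1 / (1 - H * d)) *
    (T ^ (1 - H * d) * Real.Gamma (1 - H * d))))

lemma momentConst_pos {H k₁ : ℝ} (hT : 0 < T) (hk₁ : 0 < k₁) (hHd : H * d < 1) :
    0 < momentConst d T H k₁ := by
  have h1 : 0 < 1 - H * d := by linarith
  have h2 := Real.Gamma_pos_of_pos h1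
  have h3 := stepConst_pos hk₁
  unfold momentConst
  positivity

/-- Moment bound for the approximate local time, uniform in `ε`. -/
lemma integral_approxLocalTime_pow_le [IsProbabilityMeasure P]
    (hB : Measurable fun q : ℝ≥0 × Ω => B q.1 q.2) (hT : 0 < T) {h : ℝ≥0 → E}
    (hG : HasGaussianIncrements B P h) {H k₁ : ℝ} (hk₁ : 0 < k₁) (hH : 0 < H) (hd : d ≠ 0)
    (hHd : H * d < 1) (hloc : IsLocallyNondeterministic h T H k₁) {ε : ℝ} (hε : 0 < ε) {n : ℕ}
    (hn : 1 ≤ n) :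
    ∫ ω, approxLocalTime B T ε ω ^ n ∂P ≤
      momentConst d T H k₁ ^ n * (n.factorial : ℝ) ^ (H * d) := by
  have hHd0 : 0 < H * d := mul_pos hH (by exact_mod_cast Nat.pos_of_ne_zero hd)
  have hC := momentConst_pos hT hk₁ hHd
  have hint := integrable_prod_crossing (P := P) (T := T) (n := n) hB (fun _ => hε)
  have hmom := integral_prod_approxLocalTime (P := P) (n := n) hB hT.le (fun _ => hε)
  simp only [Finset.prod_const, Finset.card_univ, Fintype.card_fin] at hmom
  rw [hmom, ← ENNReal.ofReal_le_ofReal_iff (by positivity),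
    ofReal_integral_eq_lintegral_ofReal hint.integral_prod_left (ae_of_all _ fun x =>
      integral_nonneg fun ω => Finset.prod_nonneg fun k _ => crossing_nonneg hε _ _)]
  have hmeas : Measurable fun x : Fin n → ℝ × ℝ =>
      ENNReal.ofReal (∫ ω, ∏ k, crossing B T ε (x k) ω ∂P) :=
    (measurable_prod_crossing hB fun _ => ε).stronglyMeasurable.integral_prod_right'
      |>.measurable.ennreal_ofReal
  -- The integrand is symmetric since all regularisation parameters are equal; sorting by the larger
  -- time t prepares the chain estimate.
  refine (lintegral_le_factorial_mul_sorted
    hmeas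
    (fun σ x => ?_) measurable_fst).trans ?_
  · congr 2
    funext ω
    exact Equiv.prod_comp σ fun k => crossing B T ε (x k) ω
  calc _ ≤ (n.factorial : ℝ≥0∞) * ∫⁻ x : Fin n → ℝ × ℝ,
        ENNReal.ofReal (stepConst k₁ ^ d) ^ n * chainWeight T (H * d) x := by
        refine mul_le_mul_right (lintegral_mono fun x => ?_) _
        by_cases hmono : Monotone (Prod.fst ∘ x)
        · rw [Set.indicator_of_mem (by exact hmono), integral_prod_crossing hB hG fun _ => hε]
          by_cases hx : ∀ k, x k ∈ timeSimplex T
          · rw [Set.indicator_of_mem (by exact hx)]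
            exact ofReal_regGaussian_pow_le hk₁ hH hloc hd (fun _ => hε) x hx hmono
          · rw [Set.indicator_of_notMem (by exact hx), ENNReal.ofReal_zero]
            exact zero_le
        · rw [Set.indicator_of_notMem (by exact hmono)]
          exact zero_le
    _ = ENNReal.ofReal (stepConst k₁ ^ d) ^ n *
        ((n.factorial : ℝ≥0∞) * ∫⁻ x : Fin n → ℝ × ℝ, chainWeight T (H * d) x) := by
        rw [lintegral_const_mul _ (measurable_chainWeight T _)]
        ring
    _ ≤ _ := by
        refine (mul_le_mul_right
          (factorial_mul_lintegral_chainWeight_le hT hHd hHd0 hn) _).trans (le_of_eq ?_)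
        have := stepConst_pos hk₁
        rw [← ENNReal.ofReal_pow (by positivity), ← ENNReal.ofReal_mul (by positivity), momentConst]
        congr 1
        rw [mul_pow (stepConst k₁ ^ d)]
        ring

end Moments

/-! ### Local nondeterminism of the kernel curve. -/

section KernelCurve

variable {Ω : Type*} [MeasurableSpace Ω] {P : Measure Ω} {d : ℕ}
  {W B : ℝ≥0 → Ω → EuclideanSpace ℝ (Fin d)} {K : ℝ → ℝ → ℝ}

/-- Square integrable functions with vanishing product are orthogonal. -/
lemma inner_toLp_eq_zero {μ : Measure ℝ} {f g : ℝ → ℝ} (hf : MemLp f 2 μ) (hg : MemLp g 2 μ)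
    (h : ∀ x, f x * g x = 0) : ⟪hf.toLp f, hg.toLp g⟫ = 0 := by
  rw [L2.inner_def]
  refine integral_eq_zero_of_ae ?_
  filter_upwards [hf.coeFn_toLp, hg.coeFn_toLp] with x h1 h2
  rw [h1, h2]
  simpa [mul_comm] using h x

lemma norm_sq_toLp {μ : Measure ℝ} {f : ℝ → ℝ} (hf : MemLp f 2 μ) :
    ‖hf.toLp f‖ ^ 2 = ∫ x, f x ^ 2 ∂μ := by
  rw [← real_inner_self_eq_norm_sq, L2.inner_def]
  refine integral_congr_ae ?_
  filter_upwards [hf.coeFn_toLp] with x h1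
  rw [h1]
  simp [sq]

/-- The witness is K(t,·) restricted to (r,t]: its support is disjoint from that of every earlier
h(u) and from that of the remainder of h(t), and its squared norm is exactly the integral bounded
below by `hK`. -/
lemma isLocallyNondeterministic_kernel {T H k₁ : ℝ}
    (hmem : ∀ t : ℝ≥0, MemLp ((Set.Ioc 0 (t : ℝ)).indicator (K t)) 2 timeMeasure)
    (hK : ∀ s t : ℝ, 0 ≤ s → s < t → t ≤ T →
      k₁ * (t - s) ^ (2 * H) ≤ ∫ θ in s..t, K t θ ^ 2) :
    IsLocallyNondeterministic (fun t => (hmem t).toLp _) T H k₁ := by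
  intro r t hrt htT
  have hrt' : (r : ℝ) < t := hrt
  have hw : MemLp ((Set.Ioc (r : ℝ) t).indicator ((Set.Ioc 0 (t : ℝ)).indicator (K t))) 2
      timeMeasure := (hmem t).indicator measurableSet_Ioc
  refine ⟨hw.toLp _, fun u hu => inner_toLp_eq_zero _ _ fun x => ?_, ?_, ?_⟩
  · have hu' : (u : ℝ) ≤ r := hu
    simp only [Set.indicator_apply, Set.mem_Ioc]
    by_cases hx : x ≤ u
    · simp [not_lt.2 (hx.trans hu')]
    · simp [hx]
  · rw [← MemLp.toLp_sub]
    refine inner_toLp_eq_zero _ _ fun x => ?_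
    simp only [Pi.sub_apply]
    by_cases hx : x ∈ Set.Ioc (r : ℝ) t
    · rw [Set.indicator_of_mem hx, sub_self, zero_mul]
    · rw [Set.indicator_of_notMem hx, mul_zero]
  · refine (hK r t r.2 hrt' htT).trans (le_of_eq ?_)
    rw [norm_sq_toLp, intervalIntegral.integral_of_le hrt'.le, ← integral_indicator
      measurableSet_Ioc, timeMeasure, ← integral_indicator measurableSet_Ici]
    refine integral_congr_ae (ae_of_all _ fun x => ?_)
    by_cases hx : x ∈ Set.Ioc (r : ℝ) t
    · have h0 : (0 : ℝ) < x := (NNReal.coe_nonneg r).trans_lt hx.1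
      rw [Set.indicator_of_mem hx, Set.indicator_of_mem (Set.mem_Ici.2 h0.le),
        Set.indicator_of_mem hx, Set.indicator_of_mem (Set.mem_Ioc.2 ⟨h0, hx.2⟩)]
    · rw [Set.indicator_of_notMem hx, Set.indicator_apply]
      simp [Set.indicator_of_notMem hx]

end KernelCurve

/-! ### The L² limit and its moments. -/

section Limit

/-- A curve in a Hilbert space that is monotone and bounded in the quadratic sense has a limit
at `0⁺`. -/
lemma exists_tendsto_of_norm_sq_le_inner {F : Type*} [NormedAddCommGroup F] [InnerProductSpace ℝ F]
    [CompleteSpace F] {f : ℝ → F} {M : ℝ}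
    (hinner : ∀ ε η, 0 < ε → ε ≤ η → ‖f η‖ ^ 2 ≤ ⟪f ε, f η⟫)
    (hM : ∀ ε, 0 < ε → ‖f ε‖ ^ 2 ≤ M) : ∃ l, Tendsto f (𝓝[>] 0) (𝓝 l) := by
  have hdist : ∀ ε η, 0 < ε → ε ≤ η → dist (f ε) (f η) ^ 2 ≤ ‖f ε‖ ^ 2 - ‖f η‖ ^ 2 := by
    intro ε η hε hεη
    rw [dist_eq_norm, norm_sub_sq_real]
    linarith [hinner ε η hε hεη]
  have hanti : ∀ ε η, 0 < ε → ε ≤ η → ‖f η‖ ^ 2 ≤ ‖f ε‖ ^ 2 := by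
    intro ε η hε hεη
    linarith [hdist ε η hε hεη, sq_nonneg (dist (f ε) (f η))]
  rw [← cauchy_map_iff_exists_tendsto, Metric.cauchy_iff]
  refine ⟨inferInstance, fun δ hδ => ?_⟩
  set A : Set ℝ := (fun ε => ‖f ε‖ ^ 2) '' Set.Ioi 0 with hA
  have hbdd : BddAbove A := ⟨M, by rintro _ ⟨ε, hε, rfl⟩; exact hM ε hε⟩
  have hne : A.Nonempty := ⟨_, 1, Set.mem_Ioi.2 one_pos, rfl⟩
  -- Squared norms increase as ε decreases, so below an ε₀ nearly attaining the supremum they vary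
  -- by less than δ², and this controls the squared distance.
  obtain ⟨_, ⟨ε₀, hε₀, rfl⟩, hlt⟩ := exists_lt_of_lt_csSup hne
    (show sSup A - δ ^ 2 < sSup A by linarith [pow_pos hδ 2])
  simp only at hlt
  have hsup : ∀ ε, 0 < ε → ‖f ε‖ ^ 2 ≤ sSup A := fun ε hε => le_csSup hbdd ⟨ε, hε, rfl⟩
  have key : ∀ ε η, 0 < ε → ε ≤ η → η ≤ ε₀ → dist (f ε) (f η) < δ := by
    intro ε η hε hεη hη
    refine lt_of_pow_lt_pow_left₀ 2 hδ.le ?_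
    linarith [hdist ε η hε hεη, hsup ε hε, hanti η ε₀ (hε.trans_le hεη) hη]
  refine ⟨f '' Set.Ioc 0 ε₀, image_mem_map (Ioc_mem_nhdsGT hε₀), ?_⟩
  rintro _ ⟨ε, hε, rfl⟩ _ ⟨η, hη, rfl⟩
  rcases le_total ε η with hle | hle
  · exact key ε η hε.1 hle hη.2
  · rw [dist_comm]
    exact key η ε hη.1 hle hε.2

variable {Ω : Type*} [MeasurableSpace Ω] {P : Measure Ω} {d : ℕ}
  {B : ℝ≥0 → Ω → EuclideanSpace ℝ (Fin d)} {T H k₁ : ℝ}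
  {E : Type*} [NormedAddCommGroup E] [InnerProductSpace ℝ E] {h : ℝ≥0 → E}

lemma memLp_approxLocalTime [IsProbabilityMeasure P]
    (hB : Measurable fun q : ℝ≥0 × Ω => B q.1 q.2) (hT : 0 ≤ T) {ε : ℝ}
    (hε : 0 < ε) : MemLp (approxLocalTime B T ε) 2 P := by
  have h1 := integrable_prod_approxLocalTime (P := P) (n := 1) hB hT fun _ => hε
  have h2 := integrable_prod_approxLocalTime (P := P) (n := 2) hB hT fun _ => hε
  simp only [Finset.prod_const, Finset.card_univ, Fintype.card_fin, pow_one] at h1 h2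
  exact (memLp_two_iff_integrable_sq h1.1).2 h2

/-- Existence of the self-intersection local time as an `L²` limit. -/
lemma exists_isSelfIntersectionLocalTime [IsProbabilityMeasure P]
    (hB : Measurable fun q : ℝ≥0 × Ω => B q.1 q.2)
    (hT : 0 < T) (hG : HasGaussianIncrements B P h) (hk₁ : 0 < k₁) (hH : 0 < H) (hd : d ≠ 0)
    (hHd : H * d < 1) (hloc : IsLocallyNondeterministic h T H k₁) :
    ∃ L : Ω → ℝ, IsSelfIntersectionLocalTime B P T L := by
  classical
  have hmem : ∀ ε, 0 < ε → MemLp (approxLocalTime B T ε) 2 P := fun ε hε =>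
    memLp_approxLocalTime hB hT.le hε
  -- The value 0 for ε ≤ 0 is irrelevant, the limit being taken from the right.
  let f : ℝ → Lp ℝ 2 P := fun ε => if hε : 0 < ε then (hmem ε hε).toLp _ else 0
  have hf : ∀ ε, 0 < ε → f ε =ᵐ[P] approxLocalTime B T ε := fun ε hε => by
    simp only [f, dif_pos hε]
    exact (hmem ε hε).coeFn_toLp
  have hinner : ∀ ε η, 0 < ε → 0 < η →
      ⟪f ε, f η⟫ = ∫ ω, ∏ k, approxLocalTime B T ((![ε, η] : Fin 2 → ℝ) k) ω ∂P := by
    intro ε η hε hη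
    rw [L2.inner_def]
    refine integral_congr_ae ?_
    filter_upwards [hf ε hε, hf η hη] with ω h1 h2
    rw [h1, h2]
    simp [Fin.prod_univ_two, mul_comm]
  have hpos : ∀ ε η : ℝ, 0 < ε → 0 < η → ∀ k, 0 < (![ε, η] : Fin 2 → ℝ) k := by
    intro ε η hε hη k
    fin_cases k
    · exact hε
    · exact hη
  obtain ⟨l, hl⟩ := exists_tendsto_of_norm_sq_le_inner (f := f)
    (M := momentConst d T H k₁ ^ 2 * (Nat.factorial 2 : ℝ) ^ (H * d)) (by
      intro ε η hε hεη
      have hη := hε.trans_le hεη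
      rw [← real_inner_self_eq_norm_sq, hinner _ _ hη hη, hinner _ _ hε hη]
      refine integral_prod_approxLocalTime_anti hB hT.le hG (hpos _ _ hε hη) fun k => ?_
      fin_cases k
      · exact hεη
      · exact le_rfl) (by
      intro ε hε
      rw [← real_inner_self_eq_norm_sq, hinner _ _ hε hε]
      have := integral_approxLocalTime_pow_le hB hT hG hk₁ hH hd hHd hloc hε one_le_two
      simpa [Fin.prod_univ_two, sq] using this)
  refine ⟨l, hmem, Lp.memLp l, ?_⟩
  rw [Lp.tendsto_Lp_iff_tendsto_eLpNorm'] at hl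
  refine hl.congr' ?_
  filter_upwards [self_mem_nhdsWithin] with ε hε
  refine eLpNorm_congr_ae ?_
  filter_upwards [hf ε hε] with ω h1
  rw [Pi.sub_apply, h1]

/-- The local time is an almost sure limit of approximate local times along a sequence. -/
lemma IsSelfIntersectionLocalTime.exists_seq_tendsto_ae {L : Ω → ℝ}
    (hL : IsSelfIntersectionLocalTime B P T L) :
    ∃ ε : ℕ → ℝ, (∀ m, 0 < ε m) ∧
      ∀ᵐ ω ∂P, Tendsto (fun m => approxLocalTime B T (ε m) ω) atTop (𝓝 (L ω)) := by
  let u : ℕ → ℝ := fun m => 1 / ((m : ℝ) + 1)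
  have hu : ∀ m, 0 < u m := fun m => by positivity
  have hu0 : Tendsto u atTop (𝓝[>] 0) :=
    tendsto_nhdsWithin_iff.2 ⟨tendsto_one_div_add_atTop_nhds_zero_nat, Eventually.of_forall hu⟩
  have hmeas : TendstoInMeasure P (fun m => approxLocalTime B T (u m)) atTop L :=
    tendstoInMeasure_of_tendsto_eLpNorm (p := 2) two_ne_zero (fun m => (hL.1 _ (hu m)).1) hL.2.1.1
      (hL.2.2.comp hu0)
  obtain ⟨ns, -, hns⟩ := hmeas.exists_seq_tendsto_ae
  exact ⟨fun m => u (ns m), fun m => hu _, hns⟩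

lemma IsSelfIntersectionLocalTime.nonneg (hB : Measurable fun q : ℝ≥0 × Ω => B q.1 q.2)
    (hT : 0 ≤ T) {L : Ω → ℝ} (hL : IsSelfIntersectionLocalTime B P T L) : ∀ᵐ ω ∂P, 0 ≤ L ω := by
  obtain ⟨ε, hε, hlim⟩ := hL.exists_seq_tendsto_ae
  filter_upwards [hlim] with ω hω
  exact ge_of_tendsto' hω fun m => approxLocalTime_nonneg hB hT (hε m) ω

/-- Fatou's lemma along an almost surely convergent sequence, combined with the moment bound uniform
in ε. -/
lemma IsSelfIntersectionLocalTime.lintegral_pow_le [IsProbabilityMeasure P]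
    (hB : Measurable fun q : ℝ≥0 × Ω => B q.1 q.2)
    (hT : 0 < T) (hG : HasGaussianIncrements B P h) (hk₁ : 0 < k₁) (hH : 0 < H) (hd : d ≠ 0)
    (hHd : H * d < 1) (hloc : IsLocallyNondeterministic h T H k₁) {L : Ω → ℝ}
    (hL : IsSelfIntersectionLocalTime B P T L) {n : ℕ} (hn : 1 ≤ n) :
    ∫⁻ ω, ENNReal.ofReal (L ω ^ n) ∂P ≤
      ENNReal.ofReal (momentConst d T H k₁ ^ n * (n.factorial : ℝ) ^ (H * d)) := by
  obtain ⟨ε, hε, hlim⟩ := hL.exists_seq_tendsto_ae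
  have hliminf : ∀ᵐ ω ∂P, ENNReal.ofReal (L ω ^ n) =
      liminf (fun m => ENNReal.ofReal (approxLocalTime B T (ε m) ω ^ n)) atTop := by
    filter_upwards [hlim] with ω hω
    exact (ENNReal.tendsto_ofReal (hω.pow n)).liminf_eq.symm
  rw [lintegral_congr_ae hliminf]
  refine (lintegral_liminf_le' fun m =>
    ((hL.1 _ (hε m)).1.aemeasurable.pow_const n).ennreal_ofReal).trans ?_
  refine liminf_le_of_le (by isBoundedDefault) fun b hb => ?_
  obtain ⟨m, hm⟩ := hb.exists
  refine hm.trans ?_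
  have hint := integrable_prod_approxLocalTime (P := P) (n := n) hB hT.le fun _ => hε m
  simp only [Finset.prod_const, Finset.card_univ, Fintype.card_fin] at hint
  rw [← ofReal_integral_eq_lintegral_ofReal hint
    (ae_of_all _ fun ω => pow_nonneg (approxLocalTime_nonneg hB hT.le (hε m) ω) n)]
  exact ENNReal.ofReal_le_ofReal
    (integral_approxLocalTime_pow_le hB hT hG hk₁ hH hd hHd hloc (hε m) hn)

end Limit

/-! ### From moment bounds to exponential integrability. -/

section ExponentialMoments

lemma rpow_le_add_mul_pow {x a r : ℝ} (hx : 0 ≤ x) (ha : 0 < a) (hr : 0 ≤ r) {n : ℕ}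
    (hrn : r ≤ n) : x ^ r ≤ a ^ r + a ^ (r - n) * x ^ n := by
  rcases le_total x a with h | h
  · have h1 : x ^ r ≤ a ^ r := Real.rpow_le_rpow hx h hr
    have h2 : 0 ≤ a ^ (r - n) * x ^ n := by positivity
    linarith
  · have hx0 : 0 < x := ha.trans_le h
    have h1 : x ^ r = x ^ (r - n) * x ^ n := by
      rw [← Real.rpow_natCast x n, ← Real.rpow_add hx0, sub_add_cancel]
    have h2 : x ^ (r - n) ≤ a ^ (r - n) := Real.rpow_le_rpow_of_nonpos ha h (by linarith)
    have h3 : 0 ≤ a ^ r := by positivity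
    rw [h1]
    have := mul_le_mul_of_nonneg_right h2 (pow_nonneg hx n)
    linarith

variable {Ω : Type*} [MeasurableSpace Ω] {P : Measure Ω} {L : Ω → ℝ}
  {C γ : ℝ}

/-- Interpolation of the moment bounds to real exponents `k / γ`. -/
lemma lintegral_rpow_le [IsProbabilityMeasure P]
    (hL0 : ∀ᵐ ω ∂P, 0 ≤ L ω) (hC : 0 < C) (hγ0 : 0 < γ) (hγ1 : γ < 1)
    (hmom : ∀ n : ℕ, 1 ≤ n → ∫⁻ ω, ENNReal.ofReal (L ω ^ n) ∂P ≤
      ENNReal.ofReal (C ^ n * (n.factorial : ℝ) ^ γ)) {k : ℕ} (hk : 1 ≤ k) :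
    ∫⁻ ω, ENNReal.ofReal (L ω ^ (1 / γ * k)) ∂P ≤
      ENNReal.ofReal (2 * (C ^ (1 / γ) * (2 / γ)) ^ k * (k : ℝ) ^ k) := by
  set n := ⌈1 / γ * k⌉₊ with hn
  have hk1 : (1 : ℝ) ≤ k := by exact_mod_cast hk
  have hγk : 1 ≤ 1 / γ * k := by
    have : 1 ≤ 1 / γ := (one_le_div hγ0).2 hγ1.le
    nlinarith
  have hn1 : 1 ≤ n := Nat.one_le_iff_ne_zero.2 (Nat.ceil_pos.2 (by linarith)).ne'
  have hn0 : (0 : ℝ) < n := by exact_mod_cast hn1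
  have hrn : 1 / γ * k ≤ n := Nat.le_ceil _
  have hn2 : (n : ℝ) ≤ 2 / γ * k := by
    have := (Nat.ceil_lt_add_one (by linarith : 0 ≤ 1 / γ * k)).le
    calc (n : ℝ) ≤ 1 / γ * k + 1 := this
      _ ≤ 1 / γ * k + 1 / γ * k := by linarith
      _ = 2 / γ * k := by ring
  -- This threshold bounds the n-th moment by a^n, so the two terms of `rpow_le_add_mul_pow`
  -- contribute at most a^{k/γ} each. As n is at most 2k/γ, this is of order k^k up to a geometric
  -- factor.
  set a := C * (n : ℝ) ^ γ with ha
  have ha0 : 0 < a := by positivity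
  have hmom' : ∫⁻ ω, ENNReal.ofReal (L ω ^ n) ∂P ≤ ENNReal.ofReal (a ^ n) := by
    refine (hmom n hn1).trans (ENNReal.ofReal_le_ofReal ?_)
    rw [ha, mul_pow]
    refine mul_le_mul_of_nonneg_left ?_ (by positivity)
    rw [← Real.rpow_natCast (_ ^ γ), ← Real.rpow_mul hn0.le, mul_comm γ, Real.rpow_mul hn0.le,
      Real.rpow_natCast]
    refine Real.rpow_le_rpow (by positivity) ?_ hγ0.le
    exact_mod_cast Nat.factorial_le_pow n
  calc _ ≤ ∫⁻ ω, (ENNReal.ofReal (a ^ (1 / γ * k)) +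
        ENNReal.ofReal (a ^ (1 / γ * k - n)) * ENNReal.ofReal (L ω ^ n)) ∂P := by
        refine lintegral_mono_ae ?_
        filter_upwards [hL0] with ω hω
        rw [← ENNReal.ofReal_mul (by positivity), ← ENNReal.ofReal_add (by positivity)
          (by positivity)]
        exact ENNReal.ofReal_le_ofReal (rpow_le_add_mul_pow hω ha0 (by linarith) hrn)
    _ ≤ ENNReal.ofReal (a ^ (1 / γ * k)) +
        ENNReal.ofReal (a ^ (1 / γ * k - n)) * ENNReal.ofReal (a ^ n) := by
        rw [lintegral_add_left measurable_const, lintegral_const, measure_univ, mul_one,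
          lintegral_const_mul' _ _ ENNReal.ofReal_ne_top]
        gcongr
    _ = ENNReal.ofReal (2 * a ^ (1 / γ * k)) := by
        rw [← ENNReal.ofReal_mul (by positivity), ← Real.rpow_natCast a n, ← Real.rpow_add ha0,
          sub_add_cancel, ← ENNReal.ofReal_add (by positivity) (by positivity), two_mul]
    _ ≤ _ := by
        refine ENNReal.ofReal_le_ofReal ?_
        rw [mul_assoc]
        refine mul_le_mul_of_nonneg_left ?_ zero_le_two
        rw [← mul_pow, Real.rpow_mul ha0.le, Real.rpow_natCast]
        refine pow_le_pow_left₀ (by positivity) ?_ k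
        rw [ha, Real.mul_rpow hC.le (by positivity), ← Real.rpow_mul hn0.le,
          mul_one_div_cancel hγ0.ne', Real.rpow_one, mul_assoc]
        exact mul_le_mul_of_nonneg_left hn2 (by positivity)

/-- The threshold for exponential integrability. -/
def expThreshold (C γ : ℝ) : ℝ := (C ^ (1 / γ) * (2 / γ) * Real.exp 1)⁻¹

lemma expThreshold_pos (hC : 0 < C) (hγ0 : 0 < γ) : 0 < expThreshold C γ := by
  unfold expThreshold
  positivity

/-- For positive `lam`, the exponential series is integrated termwise; the interpolated moments and
k^k / k! ≤ e^k dominate it by a geometric series whose ratio ρ is below 1 exactly under the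
threshold. -/
lemma integrable_exp_mul_rpow [IsProbabilityMeasure P]
    (hLm : AEMeasurable L P) (hL0 : ∀ᵐ ω ∂P, 0 ≤ L ω) (hC : 0 < C)
    (hγ0 : 0 < γ) (hγ1 : γ < 1)
    (hmom : ∀ n : ℕ, 1 ≤ n → ∫⁻ ω, ENNReal.ofReal (L ω ^ n) ∂P ≤
      ENNReal.ofReal (C ^ n * (n.factorial : ℝ) ^ γ)) {lam : ℝ} (hlam : lam < expThreshold C γ) :
    Integrable (fun ω => Real.exp (lam * L ω ^ (1 / γ))) P := by
  have hmeas : AEMeasurable (fun ω => Real.exp (lam * L ω ^ (1 / γ))) P :=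
    ((hLm.pow_const _).const_mul _).exp
  rcases le_or_gt lam 0 with hneg | hpos
  · refine Integrable.of_bound hmeas.aestronglyMeasurable 1 ?_
    filter_upwards [hL0] with ω hω
    rw [Real.norm_of_nonneg (Real.exp_nonneg _), Real.exp_le_one_iff]
    exact mul_nonpos_of_nonpos_of_nonneg hneg (by positivity)
  set ρ := lam * (C ^ (1 / γ) * (2 / γ) * Real.exp 1) with hρ
  have hρ0 : 0 ≤ ρ := by positivity
  have hρ1 : ρ < 1 := by
    rw [expThreshold, lt_inv_comm₀ hpos (by positivity), ← one_div, lt_div_iff₀ hpos] at hlam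
    rw [hρ, mul_comm]
    exact hlam
  have hterm : ∀ k : ℕ, ∫⁻ ω, ENNReal.ofReal ((lam * L ω ^ (1 / γ)) ^ k / k.factorial) ∂P ≤
      ENNReal.ofReal (2 * ρ ^ k) := by
    intro k
    rcases Nat.eq_zero_or_pos k with rfl | hk
    · simp
    have hk0 : (0 : ℝ) < k := by exact_mod_cast hk
    have hf0 : (0 : ℝ) < k.factorial := by exact_mod_cast k.factorial_pos
    calc _ = ∫⁻ ω, ENNReal.ofReal (lam ^ k / k.factorial) *
          ENNReal.ofReal (L ω ^ (1 / γ * k)) ∂P := by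
          refine lintegral_congr_ae ?_
          filter_upwards [hL0] with ω hω
          rw [← ENNReal.ofReal_mul (by positivity), Real.rpow_mul hω, Real.rpow_natCast, mul_pow]
          congr 1
          ring
      _ ≤ ENNReal.ofReal (lam ^ k / k.factorial) *
          ENNReal.ofReal (2 * (C ^ (1 / γ) * (2 / γ)) ^ k * (k : ℝ) ^ k) := by
          rw [lintegral_const_mul' _ _ ENNReal.ofReal_ne_top]
          gcongr
          exact lintegral_rpow_le hL0 hC hγ0 hγ1 hmom hk
      _ ≤ _ := by
          rw [← ENNReal.ofReal_mul (by positivity)]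
          refine ENNReal.ofReal_le_ofReal ?_
          have h1 : (k : ℝ) ^ k / k.factorial ≤ Real.exp 1 ^ k := by
            rw [← Real.exp_nat_mul, mul_one]
            exact Real.pow_div_factorial_le_exp k hk0.le k
          calc _ = 2 * lam ^ k * (C ^ (1 / γ) * (2 / γ)) ^ k * ((k : ℝ) ^ k / k.factorial) := by
                ring
            _ ≤ 2 * lam ^ k * (C ^ (1 / γ) * (2 / γ)) ^ k * Real.exp 1 ^ k := by gcongr
            _ = _ := by
                rw [hρ]
                ring
  refine ⟨hmeas.aestronglyMeasurable, ?_⟩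
  rw [hasFiniteIntegral_iff_ofReal (ae_of_all _ fun ω => Real.exp_nonneg _)]
  calc _ = ∫⁻ ω, ∑' k : ℕ, ENNReal.ofReal ((lam * L ω ^ (1 / γ)) ^ k / k.factorial) ∂P := by
        refine lintegral_congr_ae ?_
        filter_upwards [hL0] with ω hω
        rw [← ENNReal.ofReal_tsum_of_nonneg (fun k => by positivity)
          (Real.summable_pow_div_factorial _), Real.exp_eq_exp_ℝ, NormedSpace.exp_eq_tsum_div]
    _ = ∑' k : ℕ, ∫⁻ ω, ENNReal.ofReal ((lam * L ω ^ (1 / γ)) ^ k / k.factorial) ∂P := by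
        refine lintegral_tsum fun k => ?_
        exact ((((hLm.pow_const _).const_mul _).pow_const k).div_const _).ennreal_ofReal
    _ ≤ ∑' k : ℕ, ENNReal.ofReal (2 * ρ ^ k) := ENNReal.tsum_le_tsum hterm
    _ < ∞ := by
        rw [← ENNReal.ofReal_tsum_of_nonneg (fun k => by positivity)
          ((summable_geometric_of_lt_one hρ0 hρ1).mul_left 2)]
        exact ENNReal.ofReal_lt_top

/-- The cut-off y solves c y^{q-p} = 1, the point beyond which c x^q dominates x^p. -/
lemma rpow_le_const_add_mul_rpow {x p q c : ℝ} (hx : 0 ≤ x) (hp : 0 ≤ p) (hpq : p < q)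
    (hc : 0 < c) : x ^ p ≤ ((1 / c) ^ (1 / (q - p))) ^ p + c * x ^ q := by
  set y := (1 / c) ^ (1 / (q - p)) with hy
  have hy0 : 0 < y := by positivity
  have hqp : 0 < q - p := by linarith
  rcases le_total x y with h | h
  · have h1 : x ^ p ≤ y ^ p := Real.rpow_le_rpow hx h hp
    have h2 : 0 ≤ c * x ^ q := by positivity
    linarith
  · have hx0 : 0 < x := hy0.trans_le h
    have h1 : 1 / c ≤ x ^ (q - p) := by
      calc 1 / c = y ^ (q - p) := by
            rw [hy, ← Real.rpow_mul (by positivity), one_div_mul_cancel hqp.ne', Real.rpow_one]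
        _ ≤ _ := Real.rpow_le_rpow hy0.le h hqp.le
    have h2 : x ^ q = x ^ (q - p) * x ^ p := by rw [← Real.rpow_add hx0, sub_add_cancel]
    have h3 : 0 ≤ y ^ p := by positivity
    have h4 : x ^ p ≤ c * x ^ q := by
      rw [h2, ← mul_assoc]
      refine le_mul_of_one_le_left (by positivity) ?_
      rwa [div_le_iff₀ hc, mul_comm] at h1
    linarith

lemma integrable_exp_rpow (hLm : AEMeasurable L P) (hL0 : ∀ᵐ ω ∂P, 0 ≤ L ω) {lam q : ℝ}
    (hlam : 0 < lam) (hexp : Integrable (fun ω => Real.exp (lam * L ω ^ q)) P) {p : ℝ}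
    (hp : 0 ≤ p) (hpq : p < q) : Integrable (fun ω => Real.exp (L ω ^ p)) P := by
  refine (hexp.const_mul (Real.exp (((1 / lam) ^ (1 / (q - p))) ^ p))).mono'
    (hLm.pow_const _).exp.aestronglyMeasurable ?_
  filter_upwards [hL0] with ω hω
  rw [Real.norm_of_nonneg (Real.exp_nonneg _), ← Real.exp_add]
  exact Real.exp_le_exp.2 (rpow_le_const_add_mul_rpow hω hp hpq hlam)

end ExponentialMoments

end SelfIntersection

end

/-! ### The main theorem. -/

theorem theorem1 (d : ℕ) (hd : 1 ≤ d) (T H k₁ : ℝ) (hT : 0 < T) (hH0 : 0 < H) (hH1 : H < 1)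
    (hk₁ : 0 < k₁) (hHd : H * d < 1) :
    ∃ C : ℝ, 0 < C ∧ ∃ lam₀ : ℝ, 0 < lam₀ ∧
      ∀ (Ω : Type*) [MeasurableSpace Ω] (P : Measure Ω) [IsProbabilityMeasure P]
        (W B : ℝ≥0 → Ω → EuclideanSpace ℝ (Fin d)) (K : ℝ → ℝ → ℝ),
        SelfIntersection.IsBrownian W P →
        Measurable (fun q : ℝ × ℝ => K q.1 q.2) →
        (∀ t : ℝ, 0 ≤ t → IntegrableOn (fun s => K t s ^ 2) (Set.Ioc 0 t)) →
        (∀ s t : ℝ, 0 ≤ s → s < t → t ≤ T →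
          k₁ * (t - s) ^ (2 * H) ≤ ∫ θ in s..t, K t θ ^ 2) →
        Measurable (fun q : ℝ≥0 × Ω => B q.1 q.2) →
        SelfIntersection.IsKernelProcess K W B P →
        (∃ L : Ω → ℝ, SelfIntersection.IsSelfIntersectionLocalTime B P T L) ∧
        ∀ L : Ω → ℝ, SelfIntersection.IsSelfIntersectionLocalTime B P T L →
          (∀ᵐ ω ∂P, 0 ≤ L ω) ∧
          (∀ n : ℕ, 1 ≤ n → Integrable (fun ω => L ω ^ n) P ∧
            ∫ ω, L ω ^ n ∂P ≤ C ^ n * (n.factorial : ℝ) ^ (H * d)) ∧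
          (∀ p : ℝ, 0 ≤ p → p < 1 / (H * d) →
            Integrable (fun ω => Real.exp (L ω ^ p)) P) ∧
          (∀ lam : ℝ, lam < lam₀ →
            Integrable (fun ω => Real.exp (lam * L ω ^ (1 / (H * d)))) P) := by
  have hd0 : d ≠ 0 := by omega
  have hHd0 : 0 < H * d := mul_pos hH0 (by exact_mod_cast hd)
  have hC := SelfIntersection.momentConst_pos hT hk₁ hHd
  have hlam := SelfIntersection.expThreshold_pos hC hHd0
  refine ⟨SelfIntersection.momentConst d T H k₁, hC, _, hlam, ?_⟩
  intro Ω _ P _ W B K hW _ _ hK hB hBK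
  -- Square integrability is part of `IsWienerIntegral`; it is read off from coordinate 0, which
  -- exists because d ≥ 1.
  have hmem : ∀ t : ℝ≥0, MemLp ((Set.Ioc 0 (t : ℝ)).indicator (K t)) 2
      SelfIntersection.timeMeasure := fun t => (hBK t ⟨0, hd⟩).1
  have hloc := SelfIntersection.isLocallyNondeterministic_kernel hmem hK
  have hG : SelfIntersection.HasGaussianIncrements B P fun t => (hmem t).toLp _ :=
    fun n s t ξ => hBK.integral_cexp_increments hW _ (fun t => (hmem t).coeFn_toLp) s t ξ
  refine ⟨SelfIntersection.exists_isSelfIntersectionLocalTime hB hT hG hk₁ hH0 hd0 hHd hloc,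
    fun L hL => ?_⟩
  have hL0 := hL.nonneg hB hT.le
  have hLm : AEMeasurable L P := hL.2.1.1.aemeasurable
  have hmom : ∀ n : ℕ, 1 ≤ n → ∫⁻ ω, ENNReal.ofReal (L ω ^ n) ∂P ≤
      ENNReal.ofReal (SelfIntersection.momentConst d T H k₁ ^ n *
        (n.factorial : ℝ) ^ (H * d)) :=
    fun n hn => hL.lintegral_pow_le hB hT hG hk₁ hH0 hd0 hHd hloc hn
  have hexp : ∀ lam : ℝ, lam < SelfIntersection.expThreshold
      (SelfIntersection.momentConst d T H k₁) (H * d) →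
      Integrable (fun ω => Real.exp (lam * L ω ^ (1 / (H * d)))) P := fun lam hlt =>
    SelfIntersection.integrable_exp_mul_rpow hLm hL0 hC hHd0 hHd hmom hlt
  refine ⟨hL0, fun n hn => ?_, fun p hp hpq => ?_, hexp⟩
  · have hnn : ∀ᵐ ω ∂P, 0 ≤ L ω ^ n := hL0.mono fun ω hω => pow_nonneg hω n
    have hint : Integrable (fun ω => L ω ^ n) P := by
      refine ⟨(hLm.pow_const n).aestronglyMeasurable, ?_⟩
      rw [hasFiniteIntegral_iff_ofReal hnn]
      exact (hmom n hn).trans_lt ENNReal.ofReal_lt_top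
    refine ⟨hint, ?_⟩
    rw [← ENNReal.ofReal_le_ofReal_iff (by positivity),
      ofReal_integral_eq_lintegral_ofReal hint hnn]
    exact hmom n hn
  -- Any positive rate below the threshold would do; half of it is taken.
  · exact SelfIntersection.integrable_exp_rpow hLm hL0 (half_pos hlam)
      (hexp _ (half_lt_self hlam)) hp hpq
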